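/- Let $N_c\ge 3$, let $p$ be the smallest prime factor of $N_c$, and let $N_f\ge p$. For $n \ge 2$ consider multiplets $r=(r_L,r_R,b)$ of $\mathcal G[n]=SU(n)_L\times SU(n)_R\times U(1)_B$, where $r_L,r_R$ are (isomorphism classes of) continuous finite-dimensional complex irreducible representations of $SU(n)$ and $b\in\mathbb Z$ is the baryon number; left- and right-handed quarks are $q_L\sim(\square,\mathbf 1,1/N_c)$ and $q_R\sim(\mathbf 1,\square,1/N_c)$. Call $r$ color-screened if it occurs among the tensors built of $n_q$ quarks and $n_{\bar q}$ antiquarks (i.e. in $(q_L\oplus q_R)^{\otimes n_q}\otimes(\bar q_L\oplus\bar q_R)^{\otimes n_{\bar q}}$) for some $n_q,n_{\bar q}\ge 0$ with $n_q-n_{\bar q}=bN_c$. Then there is no massless hadron spectrum with unbroken chiral symmetry and full color screening: there are no integers $\ell(r)$, only finitely many of them nonzero and with $\ell(r)=0$ unless $r$ is a color-screened multiplet of $\mathcal G[N_f]$, that satisfy both of the following systems of equations. (AMC: 't Hooft anomaly matching.) The triangle anomalies of the multiplets, weighted by $\ell$, equal those of the quarks. For $[SU(N_f)_L]^3$ and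 $[SU(N_f)_L]^2U(1)_B$ this reads, for all $X\in\mathfrak{su}(N_f)$, $$\sum_r \ell(r)\,\mathrm{tr}_{r_L}(X^3)\,d(r_R)=N_c\,\mathrm{tr}_{\square}(X^3),\qquad \sum_r \ell(r)\,\mathrm{tr}_{r_L}(X^2)\,d(r_R)\,b=\mathrm{tr}_{\square}(X^2),$$ where $d$ is the dimension; the second equation says $\sum_r\ell(r)\,T(r_L)\,d(r_R)\,b=1$, with $T$ the Dynkin index normalized by $T(\square)=1$. For $[SU(N_f)_R]^3$ and $[SU(N_f)_R]^2U(1)_B$ the same equations hold with $L$ and $R$ interchanged and the right-hand sides multiplied by $-1$. (PMC: persistent mass conditions.) For $1\le h\le N_f-2$, let $$\mathcal G[N_f,h]=SU(N_f-h)_L\times SU(N_f-h)_R\times U(1)_B\times U(1)_{H_1}\times\cdots\times U(1)_{H_h}$$ act on the quarks, with $U(1)_{H_i}$ rotating both chiralities of the $i$-th flavor by a common phase and $SU(N_f-h)_{L}\times SU(N_f-h)_R$ acting on the last $N_f-h$ flavors. For every irreducible representation $r_h$ of $\mathcal G[N_f,h]$ with $b \in \mathbb Z$, integer charges $H_1=\dots=H_{h-1}=0$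 and $H_h\neq0$, $$\sum_r\ell(r)\,\kappa(r\to r_h)=0,$$ where $\kappa(r\to r_h)$ is the multiplicity of $r_h$ in the decomposition of $r$ under $\mathcal G[N_f,h]$. -/

import Mathlib

open scoped Kronecker

noncomputable section

namespace ChiralQCD

/-- The group `SU(n)`, with the topology of a set of matrices. -/
abbrev SU (n : ℕ) : Type := Matrix.specialUnitaryGroup (Fin n) ℂ

/-- The representation on `ℂ ^ d` given by a matrix-valued homomorphism. -/
def matRep {n d : ℕ} (ρ : SU n →* Matrix (Fin d) (Fin d) ℂ) :
    Representation ℂ (SU n) (Fin d → ℂ) :=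
  (Matrix.toLinAlgEquiv' : Matrix (Fin d) (Fin d) ℂ ≃ₐ[ℂ] _).toAlgHom.toMonoidHom.comp ρ

/-- A continuous finite-dimensional complex irreducible (matrix) representation of `SU(n)`. -/
structure MatIrrep (n : ℕ) where
  /-- the dimension `d(r)` -/
  dim : ℕ
  /-- the matrices of the representation -/
  mat : SU n →* Matrix (Fin dim) (Fin dim) ℂ
  continuous_mat : Continuous mat
  irreducible : (matRep mat).IsIrreducible

/-- Isomorphism of matrix representations: they are intertwined by an invertible matrix. -/
def MatIrrep.Iso {n : ℕ} (r s : MatIrrep n) : Prop :=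
  ∃ (P : Matrix (Fin r.dim) (Fin s.dim) ℂ) (Q : Matrix (Fin s.dim) (Fin r.dim) ℂ),
    P * Q = 1 ∧ Q * P = 1 ∧ ∀ g, r.mat g * P = P * s.mat g

instance isoSetoid (n : ℕ) : Setoid (MatIrrep n) where
  r := MatIrrep.Iso
  iseqv :=
    { refl := fun r => ⟨1, 1, by simp, by simp, by simp⟩
      symm := by
        rintro r s ⟨P, Q, hPQ, hQP, h⟩
        refine ⟨Q, P, hQP, hPQ, fun g => ?_⟩
        calc s.mat g * Q = (Q * P) * (s.mat g * Q) := by rw [hQP, Matrix.one_mul]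
          _ = Q * (P * s.mat g) * Q := by simp only [Matrix.mul_assoc]
          _ = Q * (r.mat g * P) * Q := by rw [h g]
          _ = Q * r.mat g * (P * Q) := by simp only [Matrix.mul_assoc]
          _ = Q * r.mat g := by rw [hPQ, Matrix.mul_one]
      trans := by
        rintro r s t ⟨P, Q, hPQ, hQP, h⟩ ⟨P', Q', hPQ', hQP', h'⟩
        refine ⟨P * P', Q' * Q, ?_, ?_, fun g => ?_⟩
        · calc P * P' * (Q' * Q) = P * (P' * Q') * Q := by simp only [Matrix.mul_assoc]
            _ = 1 := by rw [hPQ', Matrix.mul_one, hPQ]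
        · calc Q' * Q * (P * P') = Q' * (Q * P) * P' := by simp only [Matrix.mul_assoc]
            _ = 1 := by rw [hQP, Matrix.mul_one, hQP']
        · rw [← Matrix.mul_assoc, h g, Matrix.mul_assoc, h' g, Matrix.mul_assoc] }

/-- The set of irreducible representations of `SU(n)` up to isomorphism. -/
abbrev Irrep (n : ℕ) : Type := Quotient (isoSetoid n)

/-- The quantum numbers `(r_L, r_R, b)` of a multiplet of the chiral symmetry group
`SU(n)_L × SU(n)_R × U(1)_B`, with an integer baryon number `b`. -/
structure Multiplet (n : ℕ) where
  left : Irrep n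
  right : Irrep n
  baryon : ℤ

namespace Multiplet

variable {n : ℕ}

/-- A representative of `r_L`. -/
def L (r : Multiplet n) : MatIrrep n := r.left.out

/-- A representative of `r_R`. -/
def R (r : Multiplet n) : MatIrrep n := r.right.out

/-- The action of `SU(n)_L × SU(n)_R × U(1)_B` on the multiplet `(r_L, r_R, b)`, a matrix on
`r_L ⊗ r_R`. The element of `U(1)_B` is given by the phase `w` by which it multiplies a quark;
as a quark has baryon number `1 / N_c`, a multiplet of baryon number `b` gets the phase
`w ^ (N_c * b)`. -/
def act (Nc : ℕ) (r : Multiplet n) (gL gR : SU n) (w : Circle) :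
    Matrix (Fin r.L.dim × Fin r.R.dim) (Fin r.L.dim × Fin r.R.dim) ℂ :=
  (w : ℂ) ^ ((Nc : ℤ) * r.baryon) • (r.L.mat gL ⊗ₖ r.R.mat gR)

end Multiplet

/-! ### Color screening -/

/-- The action of `SU(n)_L × SU(n)_R × U(1)_B` on the quarks `(q_L, q_R)`, in the representation
`(fundamental, singlet) + (singlet, fundamental)`; `w` is the `U(1)_B` phase of a quark. -/
def quarkMat {n : ℕ} (gL gR : SU n) (w : Circle) : Matrix (Fin n ⊕ Fin n) (Fin n ⊕ Fin n) ℂ :=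
  (w : ℂ) • Matrix.fromBlocks (gL : Matrix (Fin n) (Fin n) ℂ) 0 0 (gR : Matrix (Fin n) (Fin n) ℂ)

/-- The action of `U` on tensors with `nq` indices in the space of `U` and `na` indices in the
complex conjugate space: composites of `nq` constituent quarks and `na` constituent antiquarks. -/
def constituentMat {Q : Type} (U : Matrix Q Q ℂ) (nq na : ℕ) :
    Matrix ((Fin nq → Q) × (Fin na → Q)) ((Fin nq → Q) × (Fin na → Q)) ℂ :=
  Matrix.of fun x y => (∏ k, U (x.1 k) (y.1 k)) * ∏ k, star (U (x.2 k) (y.2 k))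

/-- The multiplet occurs among the composites of `nq` quarks and `na` antiquarks. -/
def Multiplet.IsCompositeOf {n : ℕ} (Nc : ℕ) (r : Multiplet n) (nq na : ℕ) : Prop :=
  ∃ J : (Fin r.L.dim × Fin r.R.dim → ℂ) →ₗ[ℂ]
      ((Fin nq → Fin n ⊕ Fin n) × (Fin na → Fin n ⊕ Fin n) → ℂ),
    Function.Injective J ∧
      ∀ (gL gR : SU n) (w : Circle) (v : Fin r.L.dim × Fin r.R.dim → ℂ),
        J ((r.act Nc gL gR w).mulVec v) = (constituentMat (quarkMat gL gR w) nq na).mulVec (J v)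

/-- Color screening: the multiplet is made of `nq` quarks and `na` antiquarks, and
`nq - na = b * N_c` with `b` the (integer) baryon number. -/
def Multiplet.IsColorScreened {n : ℕ} (Nc : ℕ) (r : Multiplet n) : Prop :=
  ∃ nq na : ℕ, (nq : ℤ) - (na : ℤ) = r.baryon * (Nc : ℤ) ∧ r.IsCompositeOf Nc nq na

/-! ### Anomaly matching -/

/-- A one-parameter subgroup of `SU(n)`, that is, an element of its Lie algebra. -/
structure OneParam (n : ℕ) where
  path : ℝ → SU n
  continuous_path : Continuous path
  map_add : ∀ s t, path (s + t) = path s * path t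

/-- The matrix of the Lie algebra element `γ` in the fundamental representation. -/
def OneParam.fundGen {n : ℕ} (γ : OneParam n) : Matrix (Fin n) (Fin n) ℂ :=
  Matrix.of fun i j => deriv (fun t : ℝ => (γ.path t : Matrix (Fin n) (Fin n) ℂ) i j) 0

/-- The matrix of the Lie algebra element `γ` in the representation `r`. -/
def MatIrrep.gen {n : ℕ} (r : MatIrrep n) (γ : OneParam n) : Matrix (Fin r.dim) (Fin r.dim) ℂ :=
  Matrix.of fun i j => deriv (fun t : ℝ => r.mat (γ.path t) i j) 0

/-- 't Hooft anomaly matching for the triangles `[SU(n)_L]³`, `[SU(n)_R]³`, `[SU(n)_L]² U(1)_B`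
and `[SU(n)_R]² U(1)_B`. The triangles of the multiplet `r` are the traces of products of
generators over `r`: for instance `tr_{r_L}(X²) d(r_R) b`, which is `T(r_L) d(r_R) b` times
`tr(X²)`, where `T` is the Dynkin index normalized to one on the fundamental representation.
The quarks have `N_c` colors, baryon number `1 / N_c`, and opposite chiralities for `q_L`
and `q_R`. -/
structure AnomalyMatching {n : ℕ} (Nc : ℕ) (ℓ : Multiplet n →₀ ℤ) : Prop where
  cubicL : ∀ γ : OneParam n,
    (ℓ.sum fun r k => (k : ℂ) * ((r.L.gen γ ^ 3).trace * (r.R.dim : ℂ))) =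
      (Nc : ℂ) * (γ.fundGen ^ 3).trace
  cubicR : ∀ γ : OneParam n,
    (ℓ.sum fun r k => (k : ℂ) * ((r.R.gen γ ^ 3).trace * (r.L.dim : ℂ))) =
      -((Nc : ℂ) * (γ.fundGen ^ 3).trace)
  mixedL : ∀ γ : OneParam n,
    (ℓ.sum fun r k => (k : ℂ) * ((r.L.gen γ ^ 2).trace * (r.R.dim : ℂ) * (r.baryon : ℂ))) =
      (Nc : ℂ) * ((γ.fundGen ^ 2).trace * (1 / (Nc : ℂ)))
  mixedR : ∀ γ : OneParam n,
    (ℓ.sum fun r k => (k : ℂ) * ((r.R.gen γ ^ 2).trace * (r.L.dim : ℂ) * (r.baryon : ℂ))) =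
      -((Nc : ℂ) * ((γ.fundGen ^ 2).trace * (1 / (Nc : ℂ))))

/-! ### Persistent mass conditions -/

/-- The flavors, split into the first `h` ones (which are given different masses) and the
remaining `m` ones (which stay massless). -/
def flavorSplit {n h m : ℕ} (e : h + m = n) : Fin h ⊕ Fin m ≃ Fin n :=
  finSumFinEquiv.trans (finCongr e)

/-- The embedding `SU(m) → SU(n)` that acts on the last `m` flavors. -/
def embedSU {n h m : ℕ} (e : h + m = n) (u : SU m) : SU n :=
  ⟨Matrix.reindex (flavorSplit e) (flavorSplit e)
      (Matrix.fromBlocks 1 0 0 (u : Matrix (Fin m) (Fin m) ℂ)), by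
    have hu := Matrix.mem_specialUnitaryGroup_iff.1 u.2
    have h1 := Matrix.mem_unitaryGroup_iff.1 hu.1
    rw [Matrix.mem_specialUnitaryGroup_iff, Matrix.mem_unitaryGroup_iff]
    constructor
    · rw [Matrix.star_eq_conjTranspose] at h1 ⊢
      rw [Matrix.conjTranspose_reindex, Matrix.fromBlocks_conjTranspose,
        Matrix.reindex_apply, Matrix.reindex_apply, Matrix.submatrix_mul_equiv,
        Matrix.fromBlocks_multiply]
      simp [h1]
    · rw [Matrix.det_reindex_self, Matrix.det_fromBlocks_zero₂₁, hu.2]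
      simp⟩

/-- The space of equivariant maps from the irreducible representation `(s_L, s_R, b, H_1, …, H_h)`
of `SU(m)_L × SU(m)_R × U(1)_B × U(1)_{H_1} × ⋯ × U(1)_{H_h}` to the multiplet `r` of
`SU(n)_L × SU(n)_R × U(1)_B`, for `b` the baryon number of `r`. Here `U(1)_{H_i}` consists of the
elements of the latter group that multiply both chiralities of the `i`-th flavor of quarks by a
phase `z` and leave the other flavors fixed; charge `H_i` means that they act as `z ^ H_i`. -/
def branchingHom {n h m : ℕ} (Nc : ℕ) (e : h + m = n) (r : Multiplet n)
    (sL sR : MatIrrep m) (H : Fin h → ℤ) :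
    Submodule ℂ (Matrix (Fin r.L.dim × Fin r.R.dim) (Fin sL.dim × Fin sR.dim) ℂ) where
  carrier := {F |
    (∀ u v : SU m,
      r.act Nc (embedSU e u) (embedSU e v) 1 * F = F * (sL.mat u ⊗ₖ sR.mat v)) ∧
    ∀ (i : Fin h) (g : SU n) (w z : Circle),
      (w : ℂ) • (g : Matrix (Fin n) (Fin n) ℂ) =
          Matrix.diagonal (Function.update 1 (flavorSplit e (Sum.inl i)) (z : ℂ)) →
        r.act Nc g g w * F = (z : ℂ) ^ H i • F}
  add_mem' := by
    rintro F G ⟨hF, hF'⟩ ⟨hG, hG'⟩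
    refine ⟨fun u v => ?_, fun i g w z hz => ?_⟩
    · rw [Matrix.mul_add, hF, hG, Matrix.add_mul]
    · rw [Matrix.mul_add, hF' i g w z hz, hG' i g w z hz, smul_add]
  zero_mem' := by simp
  smul_mem' := by
    rintro c F ⟨hF, hF'⟩
    refine ⟨fun u v => ?_, fun i g w z hz => ?_⟩
    · rw [Matrix.mul_smul, hF, Matrix.smul_mul]
    · rw [Matrix.mul_smul, hF' i g w z hz, smul_comm]

/-- The multiplicity `κ` of the irreducible representation `(s_L, s_R, b, H_1, …, H_h)` of
`SU(m)_L × SU(m)_R × U(1)_B × U(1)_{H_1} × ⋯ × U(1)_{H_h}` in the decomposition of `r`. -/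
def branching {n h m : ℕ} (Nc : ℕ) (e : h + m = n) (r : Multiplet n)
    (sL sR : MatIrrep m) (b : ℤ) (H : Fin h → ℤ) : ℕ :=
  if r.baryon = b then Module.finrank ℂ (branchingHom Nc e r sL sR H) else 0

/-- The persistent mass conditions: for `1 ≤ h ≤ n - 2` massive flavors, the index of every
irreducible representation of `SU(n-h)_L × SU(n-h)_R × U(1)_B × U(1)_{H_1} × ⋯ × U(1)_{H_h}` with
`H_1 = ⋯ = H_{h-1} = 0` and `H_h ≠ 0` vanishes. (Below, `h = k + 1` and `m = n - h`.) -/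
def PersistentMass {n : ℕ} (Nc : ℕ) (ℓ : Multiplet n →₀ ℤ) : Prop :=
  ∀ (k m : ℕ) (e : (k + 1) + m = n), 2 ≤ m →
    ∀ (sL sR : MatIrrep m) (b : ℤ) (H : Fin (k + 1) → ℤ),
      (∀ i : Fin k, H i.castSucc = 0) → H (Fin.last k) ≠ 0 →
        (ℓ.sum fun r c => c * (branching Nc e r sL sR b H : ℤ)) = 0

end ChiralQCD

end

/-! Let `p` be a prime factor of `Nc` and `h = Nf - p`. The contradiction is `p² ∣ p(p - 1)`,
obtained by evaluating the mixed left anomaly along one direction of the torus of `SU(Nf)_L`: the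
integer weights `f` that are `0` on the first `h` flavors and `(1 - p, 1, …, 1)` on the last `p`.
They have sum `0` and sum of squares `p(p - 1)`, and they are congruent to `1` mod `p` on the last
`p` flavors.

For a multiplet realized as a space of tensors, let its moment be the sum of `d²` times the
dimension of the weight space of weight `d`. Up to a sign this is `tr X²` on the multiplet
(`Composite.trace_gen_sq`), so anomaly matching says that the moments, weighted by `ℓ(r) b`, add up
to `p(p - 1)`.

Decoupling (`PersistentMass.sum_moment_neutral`): split each multiplet by its charge under the first
flavor. Where this charge is nonzero, the persistent mass conditions kill every multiplicity of the
virtual representation of `SU(m) × SU(m)`, hence its character, hence its moment. Only the neutral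
part remains, and the argument repeats with the next flavor. After `h` steps only tensors neutral
under the first `h` flavors contribute.

Divisibility (`Composite.sq_dvd_moment_neutral`): on these tensors the last `p` flavors have total
quark number `b Nc`, which is `0` mod `p`, so the central charges of `SU(p)_L` and `SU(p)_R` are
opposite mod `p`, and each weight `d` is congruent to the left one. If `p ∣ d`, then `p² ∣ d²`. If
`d ≡ k ≢ 0`, the clock and shift matrices of `SU(p)_R` satisfy a Heisenberg relation with nontrivial
central character on the weight space, so `p` divides its dimension `m_d`; the two Heisenberg groups
together make the sum of `m_d` over `d ≡ k` divisible by `p²`. Writing `d² = k² + (d² - k²)` shows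
that `p²` divides every moment. -/

noncomputable section

namespace ChiralQCD

/-! ### Multiplicities and characters of semisimple modules. -/

section Semisimple

open Module

variable {k R : Type*} [Field k] [Ring R] [Algebra k R]

/-- Linear maps into a finite product are families of linear maps into the factors. -/
def homPiEquiv {ι : Type*} (N : Type*) [AddCommGroup N] [Module R N]
    (S : ι → Type*) [∀ i, AddCommGroup (S i)] [∀ i, Module R (S i)] [∀ i, Module k (S i)]
    [∀ i, IsScalarTower k R (S i)] :
    (N →ₗ[R] (∀ i, S i)) ≃ₗ[k] (∀ i, N →ₗ[R] S i) where
  toFun f i := LinearMap.proj i ∘ₗ f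
  invFun f := LinearMap.pi f
  map_add' _ _ := rfl
  map_smul' _ _ := rfl
  left_inv _ := rfl
  right_inv _ := rfl

theorem trace_lsmul_pi {ι : Type*} [Fintype ι] (S : ι → Type*) [∀ i, AddCommGroup (S i)]
    [∀ i, Module R (S i)] [∀ i, Module k (S i)] [∀ i, IsScalarTower k R (S i)]
    [∀ i, Module.Finite k (S i)] (r : R) :
    LinearMap.trace k (∀ i, S i) (Algebra.lsmul k k (∀ i, S i) r) =
      ∑ i, LinearMap.trace k (S i) (Algebra.lsmul k k (S i) r) := by
  classical
  have h : (Algebra.lsmul k k (∀ i, S i) r : (∀ i, S i) →ₗ[k] (∀ i, S i)) =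
      ∑ i, LinearMap.single k S i ∘ₗ (Algebra.lsmul k k (S i) r) ∘ₗ LinearMap.proj i := by
    ext i v j
    simp [Finset.sum_apply]
  rw [h, map_sum]
  refine Finset.sum_congr rfl fun i _ => ?_
  rw [LinearMap.trace_comp_comm', LinearMap.comp_assoc, LinearMap.proj_comp_single_same,
    LinearMap.comp_id]

theorem trace_lsmul_congr {M N : Type*} [AddCommGroup M] [AddCommGroup N] [Module R M]
    [Module R N] [Module k M] [Module k N] [IsScalarTower k R M] [IsScalarTower k R N]
    (e : M ≃ₗ[R] N) (r : R) :
    LinearMap.trace k M (Algebra.lsmul k k M r) = LinearMap.trace k N (Algebra.lsmul k k N r) := by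
  rw [← LinearMap.trace_conj' (Algebra.lsmul k k M r) (e.restrictScalars k)]
  congr 1
  ext v
  simp [LinearEquiv.conj_apply]

theorem finrank_hom_congr (N : Type*) {M M' : Type*} [AddCommGroup N] [AddCommGroup M]
    [AddCommGroup M'] [Module R N] [Module R M] [Module R M'] [Module k M] [Module k M']
    [IsScalarTower k R M] [IsScalarTower k R M'] (e : M ≃ₗ[R] M') :
    finrank k (N →ₗ[R] M) = finrank k (N →ₗ[R] M') :=
  LinearEquiv.finrank_eq
    { toFun := fun f => e.toLinearMap ∘ₗ f
      invFun := fun f => e.symm.toLinearMap ∘ₗ f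
      map_add' := fun f g => by ext; simp
      map_smul' := fun c f => LinearMap.ext fun x => (e.restrictScalars k).map_smul c (f x)
      left_inv := fun f => by ext; simp
      right_inv := fun f => by ext; simp }

/-- Schur's lemma: a nonzero map of simple modules is bijective, and over an algebraically closed
field the endomorphisms of a simple module are scalars. -/
theorem finrank_hom_of_isSimpleModule [IsAlgClosed k] (S T : Type*) [AddCommGroup S]
    [AddCommGroup T] [Module R S] [Module R T] [Module k S] [Module k T] [IsScalarTower k R S]
    [IsScalarTower k R T] [IsSimpleModule R S] [IsSimpleModule R T] [FiniteDimensional k S]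
    [Decidable (Nonempty (S ≃ₗ[R] T))] :
    finrank k (S →ₗ[R] T) = if Nonempty (S ≃ₗ[R] T) then 1 else 0 := by
  split_ifs with h
  · obtain ⟨e⟩ := h
    have h1 : finrank k (S →ₗ[R] S) = 1 := by
      have := IsSimpleModule.algebraMap_end_bijective_of_isAlgClosed (A := R) (V := S) k
      rw [← (LinearEquiv.ofBijective (Algebra.linearMap k (Module.End R S)) this).finrank_eq]
      exact CommSemiring.finrank_self k
    rw [← h1]
    exact (finrank_hom_congr S e).symm
  · have : Subsingleton (S →ₗ[R] T) := by
      refine ⟨fun f g => ?_⟩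
      have := (LinearMap.bijective_or_eq_zero (f - g)).resolve_left fun hb =>
        h ⟨LinearEquiv.ofBijective _ hb⟩
      exact sub_eq_zero.1 this
    exact finrank_zero_of_subsingleton

theorem exists_simple_decomposition (M : Type*) [AddCommGroup M] [Module R M] [Module k M]
    [IsScalarTower k R M] [IsSemisimpleModule R M] [FiniteDimensional k M] :
    ∃ (n : ℕ) (S : Fin n → Submodule R M), (∀ i, IsSimpleModule R (S i)) ∧
      Nonempty (M ≃ₗ[R] ∀ i, S i) := by
  have : Module.Finite R M := Module.Finite.of_restrictScalars_finite k R M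
  obtain ⟨n, S, e, hS⟩ := IsSemisimpleModule.exists_linearEquiv_fin_dfinsupp R M
  exact ⟨n, S, hS, ⟨e.trans DFinsupp.linearEquivFunOnFintype⟩⟩

/-- A virtual semisimple module in which all multiplicities vanish has zero character. -/
theorem sum_trace_eq_zero_of_sum_finrank_hom_eq_zero [IsAlgClosed k] [CharZero k] {ι : Type*}
    [Fintype ι]
    (M : ι → Type*) [∀ i, AddCommGroup (M i)] [∀ i, Module R (M i)] [∀ i, Module k (M i)]
    [∀ i, IsScalarTower k R (M i)] [∀ i, IsSemisimpleModule R (M i)]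
    [∀ i, FiniteDimensional k (M i)] (a : ι → ℤ)
    (h : ∀ j (S : Submodule R (M j)), IsSimpleModule R S →
      ∑ i, a i * (finrank k (S →ₗ[R] M i) : ℤ) = 0) (r : R) :
    ∑ i, (a i : k) * LinearMap.trace k (M i) (Algebra.lsmul k k (M i) r) = 0 := by
  classical
  choose n S hS e using fun i => exists_simple_decomposition (k := k) (R := R) (M i)
  let I := Σ i, Fin (n i)
  let T : ∀ x : I, Submodule R (M x.1) := fun x => S x.1 x.2
  have hT : ∀ x, IsSimpleModule R (T x) := fun x => hS x.1 x.2
  have hTfin : ∀ x, FiniteDimensional k (T x) := fun x =>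
    inferInstanceAs (FiniteDimensional k ((T x).restrictScalars k))
  let χ : I → k := fun x => LinearMap.trace k (T x) (Algebra.lsmul k k (T x) r)
  let rel : I → I → Prop := fun x y => Nonempty (T x ≃ₗ[R] T y)
  have rel_symm : ∀ x y, rel x y → rel y x := fun x y ⟨f⟩ => ⟨f.symm⟩
  have hχ : ∀ x y, rel x y → χ x = χ y := fun x y ⟨f⟩ => trace_lsmul_congr f r
  have hcard : ∀ x y, rel x y →
      (Finset.univ.filter (rel x)).card = (Finset.univ.filter (rel y)).card := by
    rintro x y ⟨f⟩
    congr 1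
    ext z
    simp only [Finset.mem_filter, Finset.mem_univ, true_and]
    exact ⟨fun ⟨g⟩ => ⟨f.symm.trans g⟩, fun ⟨g⟩ => ⟨f.trans g⟩⟩
  have hcard0 : ∀ x, ((Finset.univ.filter (rel x)).card : k) ≠ 0 := fun x => by
    rw [Nat.cast_ne_zero]
    exact (Finset.card_pos.2 ⟨x, by simp only [Finset.mem_filter, Finset.mem_univ, true_and]
                                    exact ⟨LinearEquiv.refl _ _⟩⟩).ne'
  -- By Schur, the multiplicity of `T x` in `M i` counts the summands of `M i` isomorphic to it, so
  -- the hypothesis at `T x` is a sum over the isomorphism class of `x`.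
  have hmult : ∀ x : I, ∑ y : I, (if rel x y then (a y.1 : k) else 0) = 0 := by
    intro x
    have h1 := h x.1 (T x) (hT x)
    have h2 : ∀ i, (finrank k (T x →ₗ[R] M i) : ℤ) =
        ∑ l : Fin (n i), if rel x ⟨i, l⟩ then 1 else 0 := by
      intro i
      have hfin : ∀ l, Module.Finite k (T x →ₗ[R] S i l) := fun l => by
        have := hTfin ⟨i, l⟩
        have := hTfin x
        exact .of_injective (LinearMap.restrictScalarsₗ k R (T x) (S i l) k) <|
          LinearMap.restrictScalars_injective _
      rw [finrank_hom_congr (T x) (e i).some, (homPiEquiv (k := k) (R := R) (T x) (fun l => S i l)).finrank_eq,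
        Module.finrank_pi_fintype, Nat.cast_sum]
      refine Finset.sum_congr rfl fun l _ => ?_
      have := hTfin x
      have := hT x
      have := hS i l
      rw [finrank_hom_of_isSimpleModule (k := k) (R := R) (T x) (S i l)]
      simp [rel, T]
    have h3 : ((∑ i, a i * (finrank k (T x →ₗ[R] M i) : ℤ) : ℤ) : k) = 0 := by rw [h1]; simp
    refine Eq.trans ?_ h3
    rw [Fintype.sum_sigma, Int.cast_sum]
    refine Finset.sum_congr rfl fun i _ => ?_
    rw [h2, Int.cast_mul, Int.cast_sum, Finset.mul_sum]
    exact Finset.sum_congr rfl fun l _ => by split_ifs <;> simp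
  have htr : ∀ i, LinearMap.trace k (M i) (Algebra.lsmul k k (M i) r) =
      ∑ l : Fin (n i), χ ⟨i, l⟩ := by
    intro i
    have : ∀ l, Module.Finite k (S i l) := fun l => hTfin ⟨i, l⟩
    rw [trace_lsmul_congr (e i).some r, trace_lsmul_pi]
  calc ∑ i, (a i : k) * LinearMap.trace k (M i) (Algebra.lsmul k k (M i) r)
      = ∑ y : I, (a y.1 : k) * χ y := by
        rw [Fintype.sum_sigma]
        exact Finset.sum_congr rfl fun i _ => by rw [htr, Finset.mul_sum]
    -- Instead of choosing representatives of the isomorphism classes, each term is spread evenly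
    -- over its class. Dividing by the class size uses characteristic zero.
    _ = ∑ y : I, ∑ x : I, if rel y x then
          (a y.1 : k) * χ y * ((Finset.univ.filter (rel y)).card : k)⁻¹ else 0 := by
        refine Finset.sum_congr rfl fun y _ => ?_
        rw [← Finset.sum_filter, Finset.sum_const, nsmul_eq_mul]
        field_simp [hcard0 y]
    _ = ∑ x : I, ∑ y : I, χ x * ((Finset.univ.filter (rel x)).card : k)⁻¹ *
          (if rel x y then (a y.1 : k) else 0) := by
        rw [Finset.sum_comm]
        refine Finset.sum_congr rfl fun x _ => Finset.sum_congr rfl fun y _ => ?_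
        by_cases hxy : rel x y
        · rw [if_pos hxy, if_pos (rel_symm _ _ hxy), hχ _ _ hxy, hcard _ _ hxy]
          ring
        · rw [if_neg hxy, if_neg fun hyx => hxy (rel_symm _ _ hyx), mul_zero]
    _ = 0 := by
        refine Finset.sum_eq_zero fun x _ => ?_
        rw [← Finset.mul_sum, hmult, mul_zero]

end Semisimple

/-! ### Burnside's theorem and irreducible representations of a product group. -/

section OuterTensor

open Module

variable {G H V : Type*} [Group G] [Group H] [AddCommGroup V] [Module ℂ V]

/-- A subspace is invariant under a representation. -/
def IsInvariant (ρ : Representation ℂ G V) (W : Submodule ℂ V) : Prop :=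
  ∀ g, ∀ w ∈ W, ρ g w ∈ W

/-- A minimal nonzero invariant subspace. -/
structure IsMinimalInvariant (ρ : Representation ℂ G V) (W : Submodule ℂ V) : Prop where
  invariant : IsInvariant ρ W
  ne_bot : W ≠ ⊥
  eq_of_le : ∀ X ≤ W, IsInvariant ρ X → X ≠ ⊥ → X = W

theorem exists_isMinimalInvariant_le [FiniteDimensional ℂ V] (ρ : Representation ℂ G V)
    (W : Submodule ℂ V) (hW : IsInvariant ρ W) (h0 : W ≠ ⊥) :
    ∃ X ≤ W, IsMinimalInvariant ρ X := by
  induction hn : finrank ℂ W using Nat.strong_induction_on generalizing W with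
  | _ n ih =>
    by_cases h : ∀ X ≤ W, IsInvariant ρ X → X ≠ ⊥ → X = W
    · exact ⟨W, le_rfl, hW, h0, h⟩
    · push Not at h
      obtain ⟨X, hXW, hX, hX0, hne⟩ := h
      obtain ⟨Y, hY, hY'⟩ := ih _ (hn ▸ Submodule.finrank_lt_finrank_of_lt (lt_of_le_of_ne hXW hne))
        X hX hX0 rfl
      exact ⟨Y, hY.trans hXW, hY'⟩

theorem isIrreducible_iff_isMinimalInvariant_top (ρ : Representation ℂ G V) :
    ρ.IsIrreducible ↔ IsMinimalInvariant ρ ⊤ := by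
  constructor
  · intro h
    refine ⟨fun _ _ _ => trivial, fun h' => ?_, fun X _ hX hX0 => ?_⟩
    · exact (bot_ne_top (α := Subrepresentation ρ))
        (Subrepresentation.toSubmodule_injective h'.symm)
    · rcases eq_bot_or_eq_top (⟨X, fun g v hv => hX g v hv⟩ : Subrepresentation ρ) with h1 | h1
      · exact absurd (congrArg Subrepresentation.toSubmodule h1) hX0
      · exact congrArg Subrepresentation.toSubmodule h1
  · intro h
    have : Nontrivial (Subrepresentation ρ) :=
      ⟨⊥, ⊤, fun h' => h.ne_bot (congrArg Subrepresentation.toSubmodule h').symm⟩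
    refine ⟨fun X => ?_⟩
    by_cases hX : X.toSubmodule = ⊥
    · exact Or.inl (Subrepresentation.toSubmodule_injective hX)
    · exact Or.inr (Subrepresentation.toSubmodule_injective
        (h.eq_of_le _ le_top (fun g v hv => X.apply_mem_toSubmodule g hv) hX))

/-- The matrices of a representation on an invariant subspace with respect to a basis. -/
def basisMat (ρ : Representation ℂ G V) {W : Submodule ℂ V} (hW : IsInvariant ρ W) {d : ℕ}
    (b : Basis (Fin d) ℂ W) : G →* Matrix (Fin d) (Fin d) ℂ :=
  (LinearMap.toMatrixAlgEquiv b : _ ≃ₐ[ℂ] Matrix (Fin d) (Fin d) ℂ).toAlgHom.toMonoidHom.comp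
    (ρ.subrepresentation W hW)

theorem apply_basis_eq_sum (ρ : Representation ℂ G V) {W : Submodule ℂ V} (hW : IsInvariant ρ W)
    {d : ℕ} (b : Basis (Fin d) ℂ W) (g : G) (j : Fin d) :
    ρ g (b j) = ∑ i, basisMat ρ hW b g i j • (b i : V) := by
  have h := b.sum_repr (ρ.subrepresentation W hW g (b j))
  have h' := congrArg (Subtype.val : W → V) h
  simp only [Submodule.coe_sum, Submodule.coe_smul] at h'
  rw [show ρ g (b j) = ((ρ.subrepresentation W hW g (b j) : W) : V) from rfl, ← h']
  refine Finset.sum_congr rfl fun i _ => ?_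
  congr 1
  simp [basisMat, LinearMap.toMatrixAlgEquiv_apply]

/-- The coordinate map `ψ` is an injective intertwiner with image `W`, so it carries invariant
subspaces to invariant subspaces of `W`. Keeping `σ` abstract lets the result apply to `matRep`. -/
theorem isMinimalInvariant_basisMat (ρ : Representation ℂ G V) {W : Submodule ℂ V}
    (hW : IsMinimalInvariant ρ W) {d : ℕ} (b : Basis (Fin d) ℂ W)
    (σ : Representation ℂ G (Fin d → ℂ))
    (hσ : ∀ g v, σ g v = (basisMat ρ hW.invariant b g).mulVec v) :
    σ.IsIrreducible := by
  rw [isIrreducible_iff_isMinimalInvariant_top]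
  let ψ : (Fin d → ℂ) →ₗ[ℂ] V := W.subtype ∘ₗ b.equivFun.symm.toLinearMap
  have hψ : Function.Injective ψ :=
    (Subtype.val_injective).comp b.equivFun.symm.injective
  have hψr : LinearMap.range ψ = W := by
    rw [LinearMap.range_comp, LinearEquiv.range, Submodule.map_top, Submodule.range_subtype]
  have hψσ : ∀ g v, ψ (σ g v) = ρ g (ψ v) := by
    intro g v
    have e1 : ∀ v, ψ v = ∑ j, v j • (b j : V) := by
      intro v
      simp [ψ, Basis.equivFun_symm_apply]
    rw [e1, e1, map_sum, hσ]
    simp_rw [map_smul, apply_basis_eq_sum ρ hW.invariant b g, Matrix.mulVec, dotProduct,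
      Finset.sum_smul, Finset.smul_sum]
    rw [Finset.sum_comm]
    refine Finset.sum_congr rfl fun j _ => Finset.sum_congr rfl fun i _ => ?_
    rw [smul_smul, mul_comm]
  refine ⟨fun _ _ _ => trivial, fun h => hW.ne_bot ?_, fun X _ hX hX0 => ?_⟩
  · rw [← hψr, LinearMap.range_eq_map, h, Submodule.map_bot]
  · have h1 : X.map ψ = W := by
      refine hW.eq_of_le _ ?_ ?_ ?_
      · rw [← hψr]; exact LinearMap.map_le_range
      · rintro g _ ⟨v, hv, rfl⟩
        exact ⟨σ g v, hX g v hv, hψσ g v⟩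
      · exact fun h => hX0 (Submodule.map_injective_of_injective hψ (by rw [h, Submodule.map_bot]))
    rw [← hψr, LinearMap.range_eq_map] at h1
    exact Submodule.map_injective_of_injective hψ h1

/-- Burnside's theorem: a finite-dimensional irreducible representation is surjective onto the
endomorphism algebra. -/
theorem asAlgebraHom_surjective [FiniteDimensional ℂ V] (ρ : Representation ℂ G V)
    (hρ : ρ.IsIrreducible) : Function.Surjective ρ.asAlgebraHom := by
  classical
  intro E
  have : IsSimpleModule (MonoidAlgebra ℂ G) ρ.asModule :=
    (Representation.irreducible_iff_isSimpleModule_asModule ρ).1 hρ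
  let R := MonoidAlgebra ℂ G
  -- By Schur the commutant consists of scalars, so any `E` is linear over it. Jacobson density then
  -- provides an element of the group algebra that agrees with `E` on a basis.
  let F : Module.End (Module.End R ρ.asModule) ρ.asModule :=
    { toFun := fun v => ρ.asModuleEquiv.symm (E (ρ.asModuleEquiv v))
      map_add' := fun v w => by simp
      map_smul' := fun f v => by
        obtain ⟨c, rfl⟩ := (IsSimpleModule.algebraMap_end_bijective_of_isAlgClosed
          (A := R) (V := ρ.asModule) ℂ).2 f
        have : ∀ w : ρ.asModule, (algebraMap ℂ (Module.End R ρ.asModule) c) • w = c • w :=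
          fun w => rfl
        simp [this] }
  let b := Module.finBasis ℂ V
  obtain ⟨r, hr⟩ := jacobson_density F (Finset.univ.image fun i => ρ.asModuleEquiv.symm (b i))
  refine ⟨r, b.ext fun i => ?_⟩
  have := hr (ρ.asModuleEquiv.symm (b i)) (Finset.mem_image_of_mem _ (Finset.mem_univ i))
  have h2 := congrArg ρ.asModuleEquiv this
  rw [Representation.asModuleEquiv_map_smul] at h2
  simpa [F] using h2.symm

/-- The outer tensor product of two matrix representations. -/
def outer {dL dR : ℕ} (ρL : G →* Matrix (Fin dL) (Fin dL) ℂ) (ρR : H →* Matrix (Fin dR) (Fin dR) ℂ) :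
    Representation ℂ (G × H) (Fin dL × Fin dR → ℂ) where
  toFun g := Matrix.toLin' (ρL g.1 ⊗ₖ ρR g.2)
  map_one' := by simp; rfl
  map_mul' g h := by
    rw [Prod.fst_mul, Prod.snd_mul, map_mul, map_mul, Matrix.mul_kronecker_mul, Matrix.toLin'_mul]
    rfl

/-- Postcomposition with a representation of `H`. -/
def postcomp (σ : Representation ℂ H V) (S : Type*) [AddCommGroup S] [Module ℂ S] :
    Representation ℂ H (S →ₗ[ℂ] V) where
  toFun h := LinearMap.compRight ℂ (σ h)
  map_one' := by ext; simp
  map_mul' g h := by ext; simp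

/-- A minimal invariant subspace of a representation of `G × H` is an outer tensor product of
irreducible representations of `G` and `H`. -/
theorem exists_outer_of_isMinimalInvariant [FiniteDimensional ℂ V]
    (ρ : Representation ℂ (G × H) V) (U : Submodule ℂ V) (hU : IsMinimalInvariant ρ U) :
    ∃ (S : Submodule ℂ V) (hS : IsMinimalInvariant (ρ.comp (MonoidHom.inl G H)) S)
      (N : Submodule ℂ (S →ₗ[ℂ] V))
      (hN : IsMinimalInvariant (postcomp (ρ.comp (MonoidHom.inr G H)) S) N)
      (dL dR : ℕ) (bS : Basis (Fin dL) ℂ S) (bN : Basis (Fin dR) ℂ N)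
      (Φ : Representation.IntertwiningMap
        (outer (basisMat _ hS.invariant bS) (basisMat _ hN.invariant bN)) ρ),
      Function.Injective Φ ∧ LinearMap.range Φ.toLinearMap = U := by
  obtain ⟨S, hSU, hS⟩ := exists_isMinimalInvariant_le (ρ.comp (MonoidHom.inl G H)) U
    (fun g w hw => hU.invariant _ w hw) hU.ne_bot
  -- The multiplicity space of `S` in `U`: the `G`-equivariant maps from `S` into `U`, on which `H`
  -- acts by postcomposition. The right-hand factor `N` is a minimal invariant subspace of it.
  let M : Submodule ℂ (S →ₗ[ℂ] V) :=
    { carrier := {f | (∀ s, f s ∈ U) ∧ ∀ g (s : S), f ⟨_, hS.invariant g s s.2⟩ = ρ (g, 1) (f s)}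
      add_mem' := by
        rintro f f' ⟨h1, h2⟩ ⟨h1', h2'⟩
        exact ⟨fun s => U.add_mem (h1 s) (h1' s), fun g s => by
          rw [LinearMap.add_apply, LinearMap.add_apply, h2, h2', map_add]⟩
      zero_mem' := ⟨fun s => U.zero_mem, fun g s => by simp⟩
      smul_mem' := by
        rintro c f ⟨h1, h2⟩
        exact ⟨fun s => U.smul_mem c (h1 s), fun g s => by
          rw [LinearMap.smul_apply, LinearMap.smul_apply, h2, map_smul]⟩ }
  have hM : IsInvariant (postcomp (ρ.comp (MonoidHom.inr G H)) S) M := by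
    rintro h f ⟨h1, h2⟩
    refine ⟨fun s => hU.invariant _ _ (h1 s), fun g s => ?_⟩
    change ρ (1, h) (f _) = ρ (g, 1) (ρ (1, h) (f s))
    rw [h2, ← Module.End.mul_apply, ← Module.End.mul_apply, ← map_mul, ← map_mul]
    simp
  have hM0 : M ≠ ⊥ := by
    intro h
    have h1 : S.subtype ∈ M := ⟨fun s => hSU s.2, fun g s => rfl⟩
    rw [h, Submodule.mem_bot] at h1
    apply hS.ne_bot
    rw [← Submodule.range_subtype S, h1, LinearMap.range_zero]
  obtain ⟨N, hNM, hN⟩ := exists_isMinimalInvariant_le _ M hM hM0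
  let bS := Module.finBasis ℂ S
  let bN := Module.finBasis ℂ N
  have hirr : (Representation.subrepresentation _ S hS.invariant).IsIrreducible := by
    rw [isIrreducible_iff_isMinimalInvariant_top]
    refine ⟨fun _ _ _ => trivial, fun h => hS.ne_bot ?_, fun X _ hX hX0 => ?_⟩
    · rw [← Submodule.range_subtype S, LinearMap.range_eq_map, h, Submodule.map_bot]
    · have h1 : X.map S.subtype = S := by
        refine hS.eq_of_le _ (Submodule.map_subtype_le S X) ?_ ?_
        · rintro g _ ⟨v, hv, rfl⟩
          exact ⟨_, hX g v hv, rfl⟩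
        · exact fun h => hX0 (Submodule.map_injective_of_injective S.injective_subtype
          (by rw [h, Submodule.map_bot]))
      apply Submodule.map_injective_of_injective S.injective_subtype
      rw [h1, Submodule.map_top, Submodule.range_subtype]
  -- The evaluation map `s ⊗ f ↦ f s`, in coordinates.
  let φ : (Fin (finrank ℂ S) × Fin (finrank ℂ N) → ℂ) →ₗ[ℂ] V :=
    ∑ x : Fin (finrank ℂ S) × Fin (finrank ℂ N),
      (LinearMap.proj x).smulRight ((bN x.2 : S →ₗ[ℂ] V) (bS x.1))
  have hφ : ∀ v, φ v = ∑ i, ∑ j, v (i, j) • (bN j : S →ₗ[ℂ] V) (bS i) := by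
    intro v
    simp [φ, LinearMap.sum_apply, Fintype.sum_prod_type]
  have hrN : ∀ (r : MonoidAlgebra ℂ G) (f : S →ₗ[ℂ] V), f ∈ N → ∀ s : S,
      f ((Representation.subrepresentation _ S hS.invariant).asAlgebraHom r s) =
        Representation.asAlgebraHom (ρ.comp (MonoidHom.inl G H)) r (f s) := by
    intro r f hf s
    induction r using MonoidAlgebra.induction_linear with
    | zero => simp
    | add x y hx hy => simp [hx, hy]
    | single g c =>
      rw [Representation.asAlgebraHom_single, Representation.asAlgebraHom_single,
        LinearMap.smul_apply, LinearMap.smul_apply, map_smul]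
      congr 1
      exact (hNM hf).2 g s
  have hφinj : Function.Injective φ := by
    rw [injective_iff_map_eq_zero]
    intro v hv
    -- Elements of the group algebra of `G` can be applied to the relation `φ v = 0`, and by
    -- Burnside they act on `S` as arbitrary endomorphisms. Rank-one choices of `E` then isolate the
    -- coefficients of a single `bS i`.
    have key : ∀ (E : Module.End ℂ S), ∑ i, ∑ j, v (i, j) • (bN j : S →ₗ[ℂ] V) (E (bS i)) = 0 := by
      intro E
      obtain ⟨r, rfl⟩ := asAlgebraHom_surjective _ hirr E
      have h1 := hφ v
      rw [hv] at h1
      have h2 := congrArg (Representation.asAlgebraHom (ρ.comp (MonoidHom.inl G H)) r) h1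
      simp only [map_sum, map_smul, map_zero] at h2
      simp only [fun i j => hrN r (bN j) (bN j).2 (bS i)]
      exact h2.symm
    ext ⟨i, j⟩
    have h1 : ∑ j, v (i, j) • bN j = 0 := by
      apply Subtype.ext
      ext s
      have := key ((bS.coord i).smulRight s)
      rw [Finset.sum_eq_single i] at this
      · simpa using this
      · intro i' _ hi'
        simp [hi']
      · simp
    exact Fintype.linearIndependent_iff.1 bN.linearIndependent _ h1 j
  have hφeq : ∀ (g : G × H) v,
      φ (outer (basisMat _ hS.invariant bS) (basisMat _ hN.invariant bN) g v) = ρ g (φ v) := by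
    rintro ⟨g, h⟩ v
    have e : ∀ i j, ρ (g, h) ((bN j : S →ₗ[ℂ] V) (bS i)) =
        ∑ i', ∑ j', (basisMat _ hS.invariant bS g i' i * basisMat _ hN.invariant bN h j' j) •
          (bN j' : S →ₗ[ℂ] V) (bS i') := by
      intro i j
      have h1 := congrArg (fun f : S →ₗ[ℂ] V => f (∑ i', basisMat _ hS.invariant bS g i' i • bS i'))
        (apply_basis_eq_sum _ hN.invariant bN h j)
      have h2 : (∑ i', basisMat _ hS.invariant bS g i' i • bS i') =
          ⟨_, hS.invariant g (bS i) (bS i).2⟩ := by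
        apply Subtype.ext
        simp only [Submodule.coe_sum, Submodule.coe_smul]
        exact (apply_basis_eq_sum _ hS.invariant bS g i).symm
      have h3 : ρ (g, h) ((bN j : S →ₗ[ℂ] V) (bS i)) =
          ρ (1, h) ((bN j : S →ₗ[ℂ] V) ⟨_, hS.invariant g (bS i) (bS i).2⟩) := by
        rw [(hNM (bN j).2).2, ← Module.End.mul_apply, ← map_mul]
        simp
      rw [h3, ← h2]
      refine h1.trans ?_
      simp only [map_sum, map_smul, LinearMap.sum_apply, LinearMap.smul_apply, Finset.smul_sum,
        smul_smul]
    rw [hφ, hφ]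
    simp only [map_sum, map_smul, e, outer, MonoidHom.coe_mk, OneHom.coe_mk, Matrix.toLin'_apply,
      Matrix.mulVec, dotProduct, Matrix.kroneckerMap_apply, Fintype.sum_prod_type,
      Finset.sum_smul, Finset.smul_sum, smul_smul]
    have swap : ∀ F : Fin (finrank ℂ S) → Fin (finrank ℂ N) → Fin (finrank ℂ S) →
        Fin (finrank ℂ N) → V,
        ∑ a, ∑ b, ∑ c, ∑ d, F a b c d = ∑ c, ∑ d, ∑ a, ∑ b, F a b c d := by
      intro F
      have := Finset.sum_comm (s := Finset.univ) (t := Finset.univ)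
        (f := fun (x y : Fin (finrank ℂ S) × Fin (finrank ℂ N)) => F x.1 x.2 y.1 y.2)
      simpa only [Fintype.sum_prod_type] using this
    rw [swap]
    refine Finset.sum_congr rfl fun i _ => Finset.sum_congr rfl fun j _ =>
      Finset.sum_congr rfl fun i' _ => Finset.sum_congr rfl fun j' _ => ?_
    rw [mul_comm]
  refine ⟨S, hS, N, hN, _, _, bS, bN, ⟨φ, fun g => LinearMap.ext fun v => hφeq g v⟩, hφinj, ?_⟩
  -- The image of `φ` is a nonzero invariant subspace of `U`, so minimality makes it all of `U`.
  refine hU.eq_of_le _ ?_ ?_ ?_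
  · rintro _ ⟨v, rfl⟩
    change φ v ∈ U
    rw [hφ]
    exact U.sum_mem fun i _ => U.sum_mem fun j _ => U.smul_mem _ ((hNM (bN j).2).1 _)
  · rintro g _ ⟨v, rfl⟩
    exact ⟨_, hφeq g v⟩
  · intro h
    have : φ = 0 := LinearMap.range_eq_bot.1 h
    obtain ⟨s, hs⟩ := Submodule.ne_bot_iff _ |>.1 hS.ne_bot
    obtain ⟨f, hf⟩ := Submodule.ne_bot_iff _ |>.1 hN.ne_bot
    have n1 : 0 < finrank ℂ S := Submodule.one_le_finrank_iff.2 hS.ne_bot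
    have n2 : 0 < finrank ℂ N := Submodule.one_le_finrank_iff.2 hN.ne_bot
    have h1 : (Pi.single (⟨0, n1⟩, ⟨0, n2⟩) 1 : Fin (finrank ℂ S) × Fin (finrank ℂ N) → ℂ) = 0 :=
      hφinj (by rw [this]; simp)
    simpa using congrFun h1 (⟨0, n1⟩, ⟨0, n2⟩)

end OuterTensor

/-! ### From vanishing multiplicities to vanishing characters for `SU(m) × SU(m)`. -/

section Multiplicities

open Module

/-- Entries in a basis of `W` are matrix coefficients of the ambient representation; this transfers
continuity to the constituents. -/
theorem exists_basisMat_eq {G V : Type*} [Group G] [AddCommGroup V] [Module ℂ V]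
    (ρ : Representation ℂ G V) {W : Submodule ℂ V} (hW : IsInvariant ρ W) {d : ℕ}
    (b : Basis (Fin d) ℂ W) (i j : Fin d) :
    ∃ θ : V →ₗ[ℂ] ℂ, ∀ g, basisMat ρ hW b g i j = θ (ρ g (b j)) := by
  obtain ⟨θ, hθ⟩ := (b.coord i).exists_extend
  refine ⟨θ, fun g => ?_⟩
  have h := LinearMap.congr_fun hθ (ρ.subrepresentation W hW g (b j))
  refine Eq.trans ?_ h.symm
  simp [basisMat, LinearMap.toMatrixAlgEquiv_apply]

/-- The irreducible matrix representation of `SU(m)` on a minimal invariant subspace. -/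
def matIrrepOfBasis {m : ℕ} {V : Type*} [AddCommGroup V] [Module ℂ V]
    (ρ : Representation ℂ (SU m) V) {W : Submodule ℂ V} (hW : IsMinimalInvariant ρ W) {d : ℕ}
    (b : Basis (Fin d) ℂ W)
    (hc : ∀ (θ : V →ₗ[ℂ] ℂ) (v : V), Continuous fun g => θ (ρ g v)) : MatIrrep m where
  dim := d
  mat := basisMat ρ hW.invariant b
  continuous_mat := by
    refine continuous_matrix fun i j => ?_
    obtain ⟨θ, hθ⟩ := exists_basisMat_eq ρ hW.invariant b i j
    simp_rw [hθ]
    exact hc θ _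
  irreducible := isMinimalInvariant_basisMat ρ hW b _ fun g v => by
    simp [matRep, Matrix.toLinAlgEquiv'_apply]

/-- The matrices of the product of two representations of `SU(m)`, as a representation of
`SU(m) × SU(m)`. -/
def MatIrrep.prodRep {m : ℕ} (sL sR : MatIrrep m) :
    Representation ℂ (SU m × SU m) (Fin sL.dim × Fin sR.dim → ℂ) :=
  outer sL.mat sR.mat

theorem finrank_hom_congr_left {k R M N P : Type*} [Field k] [Ring R] [Algebra k R]
    [AddCommGroup M] [AddCommGroup N] [AddCommGroup P] [Module R M] [Module R N] [Module R P]
    [Module k P] [IsScalarTower k R P] (e : M ≃ₗ[R] N) :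
    finrank k (M →ₗ[R] P) = finrank k (N →ₗ[R] P) :=
  LinearEquiv.finrank_eq
    { toFun := fun f => f ∘ₗ e.symm.toLinearMap
      invFun := fun f => f ∘ₗ e.toLinearMap
      map_add' := fun f g => by ext; simp
      map_smul' := fun c f => by ext; simp
      left_inv := fun f => by ext; simp
      right_inv := fun f => by ext; simp }

/-- A virtual representation of `SU(m) × SU(m)` in which all irreducible representations have
multiplicity zero has zero character. -/
theorem sum_trace_eq_zero_of_multiplicities {m : ℕ} {ι : Type*} [Fintype ι] (V : ι → Type*)
    [∀ i, AddCommGroup (V i)] [∀ i, Module ℂ (V i)] [∀ i, FiniteDimensional ℂ (V i)]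
    (ρ : ∀ i, Representation ℂ (SU m × SU m) (V i))
    (hss : ∀ i, (ρ i).IsSemisimpleRepresentation)
    (hc : ∀ i (ψ : Module.End ℂ (V i) →ₗ[ℂ] ℂ), Continuous fun g => ψ (ρ i g)) (a : ι → ℤ)
    (h : ∀ sL sR : MatIrrep m,
      ∑ i, a i * (finrank ℂ (Representation.IntertwiningMap (sL.prodRep sR) (ρ i)) : ℤ) = 0)
    (g : SU m × SU m) :
    ∑ i, (a i : ℂ) * LinearMap.trace ℂ (V i) (ρ i g) = 0 := by
  let R := MonoidAlgebra ℂ (SU m × SU m)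
  have hss' : ∀ i, IsSemisimpleModule R (ρ i).asModule := fun i =>
    (Representation.isSemisimpleRepresentation_iff_isSemisimpleModule_asModule _).1 (hss i)
  have key := sum_trace_eq_zero_of_sum_finrank_hom_eq_zero (k := ℂ) (R := R)
    (fun i => (ρ i).asModule) a ?_ (MonoidAlgebra.single g 1)
  · refine Eq.trans (Finset.sum_congr rfl fun i _ => ?_) key
    congr 1
    change LinearMap.trace ℂ (V i) (ρ i g) = LinearMap.trace ℂ (V i) _
    congr 1
    rw [← (ρ i).asAlgebraHom_single_one g]
    rfl
  · intro j T hT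
    let U : Submodule ℂ (V j) := (Subrepresentation.ofSubmodule' T).toSubmodule
    have hU : IsMinimalInvariant (ρ j) U := by
      refine ⟨fun g w hw => (Subrepresentation.ofSubmodule' T).apply_mem_toSubmodule g hw,
        fun h0 => ?_, fun X hXU hX hX0 => ?_⟩
      · apply (isSimpleModule_iff_isAtom.1 hT).1
        rw [Submodule.eq_bot_iff]
        intro x hx
        have : x ∈ U := hx
        rw [h0] at this
        exact (Submodule.mem_bot ℂ (M := V j)).1 this
      · let X' : Submodule R (ρ j).asModule :=
          Subrepresentation.asSubmodule ⟨X, fun g v hv => hX g v hv⟩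
        have h1 : X' ≤ T := fun x hx => hXU hx
        rcases (isSimpleModule_iff_isAtom.1 hT).le_iff.1 h1 with h2 | h2
        · refine absurd ?_ hX0
          rw [Submodule.eq_bot_iff]
          intro x hx
          have : x ∈ X' := hx
          rw [h2] at this
          exact (Submodule.mem_bot R (M := (ρ j).asModule)).1 this
        · refine le_antisymm hXU fun x hx => ?_
          have : x ∈ T := hx
          rw [← h2] at this
          exact this
    -- A simple constituent is an outer product of two irreducibles, which are continuous because
    -- the ambient representation is. So the multiplicities tested in `h` cover all the simple
    -- modules that are needed.
    obtain ⟨S, hS, N, hN, dL, dR, bS, bN, Φ, hΦ, hr⟩ := exists_outer_of_isMinimalInvariant (ρ j) U hU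
    let sL : MatIrrep m := matIrrepOfBasis _ hS bS fun θ v => by
      have := hc j (θ ∘ₗ LinearMap.applyₗ v)
      exact this.comp (continuous_id.prodMk continuous_const)
    let sR : MatIrrep m := matIrrepOfBasis _ hN bN fun θ v => by
      have := hc j (θ ∘ₗ LinearMap.lcomp ℂ (V j) v)
      exact this.comp (continuous_const.prodMk continuous_id)
    let Φ' : Representation.IntertwiningMap (sL.prodRep sR) (ρ j) := Φ
    let F : (sL.prodRep sR).asModule →ₗ[R] (ρ j).asModule :=
      Representation.IntertwiningMap.equivLinearMapAsModule _ _ Φ'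
    have hF : Function.Injective F := hΦ
    have hFr : LinearMap.range F = T := by
      ext x
      have : x ∈ LinearMap.range Φ.toLinearMap ↔ x ∈ U := by rw [hr]
      exact this
    let e : (sL.prodRep sR).asModule ≃ₗ[R] T :=
      (LinearEquiv.ofInjective F hF).trans (LinearEquiv.ofEq _ _ hFr)
    rw [← h sL sR]
    refine Finset.sum_congr rfl fun i _ => ?_
    rw [← finrank_hom_congr_left (k := ℂ) (R := R) (P := (ρ i).asModule) e,
      (Representation.IntertwiningMap.equivLinearMapAsModule (sL.prodRep sR) (ρ i)).finrank_eq]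

/-- The orthogonal complement of an invariant subspace is invariant, because the adjoint of each
operator is the operator of the inverse group element. -/
theorem isSemisimpleRepresentation_of_unitary {G X : Type*} [Group G] [Fintype X] [DecidableEq X]
    (ρ : Representation ℂ G (X → ℂ)) (U : G → Matrix X X ℂ)
    (hρ : ∀ g, ρ g = Matrix.toLin' (U g)) (hU : ∀ g, (U g).conjTranspose = U g⁻¹) :
    ρ.IsSemisimpleRepresentation := by
  refine ⟨fun W => ?_⟩
  let e : EuclideanSpace ℂ X ≃ₗ[ℂ] (X → ℂ) := WithLp.linearEquiv 2 ℂ (X → ℂ)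
  let W' : Submodule ℂ (EuclideanSpace ℂ X) := W.toSubmodule.comap e.toLinearMap
  have hmem : ∀ v, v ∈ (W'ᗮ).map e.toLinearMap ↔ ∀ w ∈ W.toSubmodule, v ⬝ᵥ star w = 0 := by
    intro v
    constructor
    · rintro ⟨v, hv, rfl⟩ w hw
      exact (Submodule.mem_orthogonal _ _).1 hv (e.symm w) hw
    · intro hv
      exact ⟨e.symm v, (Submodule.mem_orthogonal _ _).2 fun w hw => hv (e w) hw, rfl⟩
  have hinv : IsInvariant ρ ((W'ᗮ).map e.toLinearMap) := by
    intro g v hv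
    rw [hmem] at hv ⊢
    intro w hw
    have h1 := hv _ (W.apply_mem_toSubmodule g⁻¹ hw)
    rw [hρ, Matrix.toLin'_apply, ← hU, Matrix.star_mulVec, Matrix.conjTranspose_conjTranspose,
      dotProduct_comm, ← Matrix.dotProduct_mulVec, dotProduct_comm] at h1
    rw [hρ, Matrix.toLin'_apply]
    exact h1
  have hcompl : IsCompl W.toSubmodule ((W'ᗮ).map e.toLinearMap) := by
    have h1 := W'.isCompl_orthogonal
    have h2 := h1.map (Submodule.orderIsoMapComap e)
    have h3 : (Submodule.orderIsoMapComap e) W' = W.toSubmodule := by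
      exact Submodule.map_comap_eq_of_surjective e.surjective _
    rw [h3] at h2
    exact h2
  refine ⟨⟨_, fun g v hv => hinv g v hv⟩, ?_⟩
  constructor
  · rw [disjoint_iff]
    exact Subrepresentation.toSubmodule_injective (disjoint_iff.1 hcompl.1)
  · rw [codisjoint_iff]
    exact Subrepresentation.toSubmodule_injective (codisjoint_iff.1 hcompl.2)

theorem isSemisimpleRepresentation_subrepresentation {G V : Type*} [Group G] [AddCommGroup V]
    [Module ℂ V] (ρ : Representation ℂ G V) (hρ : ρ.IsSemisimpleRepresentation)
    (W : Submodule ℂ V) (hW : IsInvariant ρ W) :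
    (ρ.subrepresentation W hW).IsSemisimpleRepresentation := by
  rw [Representation.isSemisimpleRepresentation_iff_isSemisimpleModule_asModule] at hρ ⊢
  let f : Representation.IntertwiningMap (ρ.subrepresentation W hW) ρ := ⟨W.subtype, fun g => rfl⟩
  exact IsSemisimpleModule.of_injective
    (Representation.IntertwiningMap.equivLinearMapAsModule _ _ f) W.injective_subtype

end Multiplicities

/-! ### Tensors of quarks and antiquarks, and their charges. -/

section ConstituentMat

variable {Q : Type}

theorem constituentMat_mul [Fintype Q] (U V : Matrix Q Q ℂ) (nq na : ℕ) [DecidableEq Q] :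
    constituentMat (U * V) nq na = constituentMat U nq na * constituentMat V nq na := by
  ext x y
  simp only [constituentMat, Matrix.of_apply, Matrix.mul_apply, star_sum, star_mul']
  rw [Finset.prod_univ_sum, Finset.prod_univ_sum, Fintype.piFinset_univ, Fintype.piFinset_univ,
    Finset.sum_mul_sum, Fintype.sum_prod_type]
  refine Finset.sum_congr rfl fun i _ => Finset.sum_congr rfl fun j _ => ?_
  simp only [Finset.prod_mul_distrib]
  ring

theorem conjTranspose_constituentMat (U : Matrix Q Q ℂ) (nq na : ℕ) :
    (constituentMat U nq na).conjTranspose = constituentMat U.conjTranspose nq na := by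
  ext x y
  simp [constituentMat, Matrix.conjTranspose_apply, star_prod]

theorem constituentMat_diagonal [DecidableEq Q] (u : Q → ℂ) (nq na : ℕ) :
    constituentMat (Matrix.diagonal u) nq na =
      Matrix.diagonal fun x => (∏ k, u (x.1 k)) * ∏ k, star (u (x.2 k)) := by
  ext x y
  simp only [constituentMat, Matrix.of_apply, Matrix.diagonal_apply]
  split_ifs with h
  · subst h; simp
  · rcases not_and_or.1 (fun h' : x.1 = y.1 ∧ x.2 = y.2 => h (Prod.ext h'.1 h'.2)) with h' | h'
    · obtain ⟨k, hk⟩ := Function.ne_iff.1 h'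
      rw [Finset.prod_eq_zero (Finset.mem_univ k) (if_neg hk), zero_mul]
    · obtain ⟨k, hk⟩ := Function.ne_iff.1 h'
      rw [mul_comm, Finset.prod_eq_zero (Finset.mem_univ k) (by rw [if_neg hk, star_zero]), zero_mul]

theorem constituentMat_one [DecidableEq Q] (nq na : ℕ) :
    constituentMat (1 : Matrix Q Q ℂ) nq na = 1 := by
  rw [← Matrix.diagonal_one, constituentMat_diagonal]
  simp

/-- The charge of a basis tensor, for charges `φ` of the quarks. -/
def charge (φ : Q → ℤ) {nq na : ℕ} (x : (Fin nq → Q) × (Fin na → Q)) : ℤ :=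
  ∑ k, φ (x.1 k) - ∑ k, φ (x.2 k)

theorem constituentMat_diagonal_zpow [DecidableEq Q] (φ : Q → ℤ) (z : Circle) (nq na : ℕ) :
    constituentMat (Matrix.diagonal fun q => (z : ℂ) ^ φ q) nq na =
      Matrix.diagonal fun x => (z : ℂ) ^ charge φ x := by
  have hz : (z : ℂ) ≠ 0 := z.coe_ne_zero
  have hs : star (z : ℂ) = (z : ℂ)⁻¹ := by
    rw [← Circle.coe_inv, Circle.coe_inv_eq_conj]; rfl
  have hp : ∀ (n : ℕ) (f : Fin n → ℤ), ∏ k, (z : ℂ) ^ f k = (z : ℂ) ^ ∑ k, f k := by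
    intro n f
    induction n with
    | zero => simp
    | succ n ih => rw [Fin.prod_univ_succ, Fin.sum_univ_succ, zpow_add₀ hz, ih]
  rw [constituentMat_diagonal]
  congr 1
  ext x
  simp only [star_zpow₀, hs, inv_zpow', charge]
  rw [hp, hp, ← zpow_add₀ hz, Finset.sum_neg_distrib, sub_eq_add_neg]

end ConstituentMat

/-! ### Weight gradings, and traces as sums over weight spaces. -/

section Grading

variable {X : Type*}

/-- The functions supported on a set. -/
def suppOn (A : Set X) : Submodule ℂ (X → ℂ) where
  carrier := {v | ∀ x, x ∉ A → v x = 0}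
  add_mem' := fun h h' x hx => by simp [h x hx, h' x hx]
  zero_mem' := fun _ _ => rfl
  smul_mem' := fun c v h x hx => by simp [h x hx]

/-- A subspace is graded if it contains the homogeneous components of its elements. -/
def IsGraded {α : Type*} [DecidableEq α] (W : Submodule ℂ (X → ℂ)) (wt : X → α) : Prop :=
  ∀ c, ∀ v ∈ W, (fun x => if wt x = c then v x else 0) ∈ W

theorem IsGraded.inf_suppOn {α : Type*} [DecidableEq α] {W : Submodule ℂ (X → ℂ)} {wt : X → α}
    (h : IsGraded W wt) (A : Set X) : IsGraded (W ⊓ suppOn A) wt := by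
  intro c v hv
  exact ⟨h c v hv.1, fun x hx => by simp [hv.2 x hx]⟩

/-- Since `π` is irrational, `exp(i)` is not a root of unity, so this single phase separates all
integer weights. -/
theorem zpow_circle_exp_one_injective :
    Function.Injective fun a : ℤ => ((Circle.exp 1 : Circle) : ℂ) ^ a := by
  intro a b h
  simp only [Circle.coe_exp, ← Complex.exp_int_mul] at h
  rw [Complex.exp_eq_exp_iff_exists_int] at h
  obtain ⟨n, hn⟩ := h
  have h1 : (a : ℂ) = b + n * (2 * Real.pi) := by
    have := mul_right_cancel₀ Complex.I_ne_zero
      (show (a : ℂ) * Complex.I = (b + n * (2 * Real.pi)) * Complex.I by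
        simpa [mul_add, add_mul, mul_assoc] using hn)
    exact this
  have h2 : (a : ℝ) = b + n * (2 * Real.pi) := by exact_mod_cast h1
  by_contra hab
  have hn0 : n ≠ 0 := by
    rintro rfl
    apply hab
    have : (a : ℝ) = b := by simpa using h2
    exact_mod_cast this
  refine irrational_pi ⟨((a - b : ℤ) : ℚ) / ((2 * n : ℤ) : ℚ), ?_⟩
  have : (n : ℝ) ≠ 0 := by exact_mod_cast hn0
  push_cast
  field_simp
  linarith

/-- A subspace that is stable under a one-parameter group of phases is graded. -/
theorem isGraded_of_phase [Fintype X] {W : Submodule ℂ (X → ℂ)} {wt : X → ℤ}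
    (h : ∀ z : Circle, ∀ v ∈ W, (fun x => (z : ℂ) ^ wt x * v x) ∈ W) : IsGraded W wt := by
  classical
  intro c v hv
  let ζ : ℂ := ((Circle.exp 1 : Circle) : ℂ)
  -- Any polynomial in the operator of phase `ζ` preserves `W`; the projection onto weight `c` is
  -- such a polynomial, by Lagrange interpolation at the finitely many distinct values `ζ ^ a`.
  have hpoly : ∀ q : Polynomial ℂ, (fun x => q.eval (ζ ^ wt x) * v x) ∈ W := by
    have hm : ∀ n : ℕ, (fun x => (ζ ^ wt x) ^ n * v x) ∈ W := by
      intro n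
      induction n with
      | zero => simpa using hv
      | succ n ih =>
        have := h (Circle.exp 1) _ ih
        convert this using 2 with x
        rw [pow_succ]
        simp only [ζ]
        ring
    intro q
    induction q using Polynomial.induction_on' with
    | add p q hp hq =>
      have := W.add_mem hp hq
      convert this using 2 with x
      simp [add_mul]
    | monomial n a =>
      have := W.smul_mem a (hm n)
      convert this using 2 with x
      simp [mul_assoc]
  let s : Finset ℤ := insert c (Finset.univ.image wt)
  have := hpoly (Lagrange.interpolate s (fun a => ζ ^ a) (fun a => if a = c then 1 else 0))
  convert this using 2 with x
  rw [Lagrange.eval_interpolate_at_node (v := fun a : ℤ => ζ ^ a) _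
    (zpow_circle_exp_one_injective.injOn) (show wt x ∈ s by simp [s])]
  split_ifs <;> simp

theorem mem_suppOn_iff_phase {wt : X → ℤ} {c : ℤ} {v : X → ℂ} :
    v ∈ suppOn {x | wt x = c} ↔ ∀ z : Circle, ∀ x, (z : ℂ) ^ wt x * v x = (z : ℂ) ^ c * v x := by
  constructor
  · intro h z x
    by_cases hx : wt x = c
    · rw [hx]
    · rw [h x hx, mul_zero, mul_zero]
  · intro h x hx
    by_contra hv
    exact hx (zpow_circle_exp_one_injective (mul_right_cancel₀ hv (h (Circle.exp 1) x)))

theorem finrank_comap_subtype (W A : Submodule ℂ (X → ℂ)) :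
    Module.finrank ℂ (A.comap W.subtype) = Module.finrank ℂ (W ⊓ A : Submodule ℂ (X → ℂ)) := by
  rw [← Submodule.map_comap_subtype]
  exact (LinearEquiv.finrank_eq (Submodule.equivMapOfInjective W.subtype W.injective_subtype _))

theorem trace_eq_finrank_of_isProj {V : Type*} [AddCommGroup V] [Module ℂ V]
    [FiniteDimensional ℂ V] {P : Submodule ℂ V} {f : Module.End ℂ V} (h : LinearMap.IsProj P f) :
    LinearMap.trace ℂ V f = Module.finrank ℂ P := h.trace

/-- On a graded subspace, an operator acting by a scalar on each weight is a combination of the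
weight projections, whose traces are the dimensions of the weight spaces. -/
theorem trace_eq_sum_finrank [Fintype X] {α : Type*} [DecidableEq α] {W : Submodule ℂ (X → ℂ)} {wt : X → α}
    (hW : IsGraded W wt) (C : Finset α) (hC : ∀ x, wt x ∈ C) (s : α → ℂ) (f : Module.End ℂ W)
    (hf : ∀ (w : W) x, (f w : X → ℂ) x = s (wt x) * (w : X → ℂ) x) :
    LinearMap.trace ℂ W f =
      ∑ c ∈ C, s c * Module.finrank ℂ (W ⊓ suppOn {x | wt x = c} : Submodule ℂ (X → ℂ)) := by
  let π : α → Module.End ℂ W := fun c =>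
    { toFun := fun w => ⟨_, hW c w w.2⟩
      map_add' := fun v w => by ext x; simp only [Submodule.coe_add, Pi.add_apply]; split_ifs <;> simp
      map_smul' := fun a w => by
        ext x; simp }
  have hπ : ∀ c (w : W) x, (π c w : X → ℂ) x = if wt x = c then (w : X → ℂ) x else 0 :=
    fun c w x => rfl
  have hsum : f = ∑ c ∈ C, s c • π c := by
    ext w x
    rw [hf, LinearMap.sum_apply, Submodule.coe_sum, Finset.sum_apply,
      Finset.sum_eq_single (wt x)]
    · simp [hπ]
    · intro c _ hc
      simp [hπ, hc.symm]
    · exact fun h => absurd (hC x) h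
  rw [hsum, map_sum]
  refine Finset.sum_congr rfl fun c _ => ?_
  rw [map_smul, smul_eq_mul]
  congr 1
  have hproj : LinearMap.IsProj ((suppOn {x | wt x = c}).comap W.subtype) (π c) := by
    refine ⟨fun w x hx => ?_, fun w hw => ?_⟩
    · change (π c w : X → ℂ) x = 0
      rw [hπ, if_neg (show ¬ wt x = c from hx)]
    · ext x
      rw [hπ]
      split_ifs with hx
      · rfl
      · exact (hw x hx).symm
  rw [← finrank_comap_subtype]
  exact trace_eq_finrank_of_isProj hproj

theorem finrank_eq_sum_finrank [Fintype X] {α : Type*} [DecidableEq α] {W : Submodule ℂ (X → ℂ)} {wt : X → α}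
    (hW : IsGraded W wt) (C : Finset α) (hC : ∀ x, wt x ∈ C) :
    Module.finrank ℂ W =
      ∑ c ∈ C, Module.finrank ℂ (W ⊓ suppOn {x | wt x = c} : Submodule ℂ (X → ℂ)) := by
  have h := trace_eq_sum_finrank hW C hC (fun _ => 1) 1 (by simp)
  rw [LinearMap.trace_one] at h
  have h' : (Module.finrank ℂ W : ℂ) = ((∑ c ∈ C,
    Module.finrank ℂ (W ⊓ suppOn {x | wt x = c} : Submodule ℂ (X → ℂ)) : ℕ) : ℂ) := by
    rw [h]; push_cast; simp
  exact_mod_cast h'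

/-- The sum of the squares of the weights of a graded subspace. -/
def moment (W : Submodule ℂ (X → ℂ)) (wt : X → ℤ) (C : Finset ℤ) : ℤ :=
  ∑ d ∈ C, d ^ 2 * (Module.finrank ℂ (W ⊓ suppOn {x | wt x = d} : Submodule ℂ (X → ℂ)) : ℤ)

theorem moment_eq_sum_moment [Fintype X] {W : Submodule ℂ (X → ℂ)} {wt wt' : X → ℤ} (hW : IsGraded W wt')
    (C C' : Finset ℤ) (hC' : ∀ x, wt' x ∈ C') :
    moment W wt C = ∑ c ∈ C', moment (W ⊓ suppOn {x | wt' x = c}) wt C := by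
  simp only [moment]
  rw [Finset.sum_comm]
  refine Finset.sum_congr rfl fun d _ => ?_
  rw [← Finset.mul_sum, finrank_eq_sum_finrank (hW.inf_suppOn {x | wt x = d}) C' hC', Nat.cast_sum]
  refine congrArg _ (Finset.sum_congr rfl fun c _ => ?_)
  rw [inf_right_comm]

end Grading

/-! ### Heisenberg relations and divisibility of dimensions. -/

section Heisenberg

open Module

variable {V : Type*} [AddCommGroup V] [Module ℂ V]

/-- If two invertible operators commute up to a primitive `p`-th root of unity, then `p` divides the
dimension. -/
theorem dvd_finrank_of_mul_eq_smul [FiniteDimensional ℂ V] {p : ℕ} {ω : ℂ} (hω : IsPrimitiveRoot ω p) {a b : End ℂ V}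
    (ha : Function.Injective a) (hb : Function.Injective b) (h : a * b = ω • (b * a)) :
    p ∣ finrank ℂ V := by
  have hu : ∀ f : End ℂ V, Function.Injective f → LinearMap.det f ≠ 0 := fun f hf => by
    have := LinearMap.isUnit_det f ((LinearMap.isUnit_iff_ker_eq_bot f).2 (LinearMap.ker_eq_bot.2 hf))
    exact this.ne_zero
  -- Comparing determinants gives `ω ^ dim V = 1`.
  have h1 := congrArg LinearMap.det h
  rw [LinearMap.det_smul, map_mul, map_mul, mul_comm (LinearMap.det b)] at h1
  exact hω.dvd_of_pow_eq_one _
    (mul_right_cancel₀ (mul_ne_zero (hu a ha) (hu b hb)) (by rw [← h1, one_mul]))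

theorem pow_mul_eq_smul_of_mul_eq_smul {ω : ℂ} {a b : End ℂ V} (h : a * b = ω • (b * a)) (i : ℕ) :
    a ^ i * b = ω ^ i • (b * a ^ i) := by
  induction i with
  | zero => simp
  | succ i ih =>
    rw [pow_succ', mul_assoc, ih, mul_smul_comm, ← mul_assoc, h, smul_mul_assoc, smul_smul,
      mul_assoc, pow_succ]

/-- If `a` commutes with an invertible operator up to a primitive `p`-th root of unity and `a ^ p`
is a nonzero scalar, then `a` has `p` eigenspaces of equal dimension. -/
theorem exists_finrank_eq_mul_finrank_eigenspace [FiniteDimensional ℂ V] {p : ℕ} (hp : 0 < p) {ω κ : ℂ}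
    (hω : IsPrimitiveRoot ω p) {a b : End ℂ V} (hb : Function.Injective b)
    (h : a * b = ω • (b * a)) (hκ : κ ≠ 0) (hap : a ^ p = κ • 1) :
    ∃ μ, finrank ℂ V = p * finrank ℂ (End.eigenspace a μ) := by
  obtain ⟨μ, hμ⟩ := IsAlgClosed.exists_pow_nat_eq κ hp
  have hμ0 : μ ≠ 0 := by
    rintro rfl
    exact hκ (by rw [← hμ, zero_pow hp.ne'])
  have hp0 : (p : ℂ) ≠ 0 := Nat.cast_ne_zero.2 hp.ne'
  refine ⟨μ, ?_⟩
  -- Conjugation by `b` fixes the trace of `a ^ i` but multiplies it by a power of `ω` different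
  -- from `1`.
  have htr : ∀ i, 0 < i → i < p → LinearMap.trace ℂ V (a ^ i) = 0 := by
    intro i hi hip
    obtain ⟨u, rfl⟩ : IsUnit b :=
      (LinearMap.isUnit_iff_ker_eq_bot b).2 (LinearMap.ker_eq_bot.2 hb)
    have h1 := pow_mul_eq_smul_of_mul_eq_smul h i
    have h2 : LinearMap.trace ℂ V (a ^ i) = ω ^ i * LinearMap.trace ℂ V (a ^ i) := by
      calc LinearMap.trace ℂ V (a ^ i) = LinearMap.trace ℂ V ((a ^ i * u) * (u⁻¹ : (End ℂ V)ˣ)) := by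
            rw [mul_assoc, Units.mul_inv, mul_one]
        _ = ω ^ i * LinearMap.trace ℂ V (u * a ^ i * (u⁻¹ : (End ℂ V)ˣ)) := by
            rw [h1, smul_mul_assoc, map_smul, smul_eq_mul]
        _ = ω ^ i * LinearMap.trace ℂ V (a ^ i) := by rw [LinearMap.trace_conj]
    have h3 : (1 - ω ^ i) * LinearMap.trace ℂ V (a ^ i) = 0 := by linear_combination h2
    rcases mul_eq_zero.1 h3 with h4 | h4
    · exact absurd (sub_eq_zero.1 h4).symm (hω.pow_ne_one_of_pos_of_lt hi.ne' hip)
    · exact h4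
  -- The projection onto the `μ`-eigenspace, as the average of the powers of `μ⁻¹ a`, whose `p`-th
  -- power is `1`. Only `i = 0` contributes to its trace, which is therefore `dim V / p`.
  let P : End ℂ V := (p : ℂ)⁻¹ • ∑ i ∈ Finset.range p, (μ⁻¹) ^ i • a ^ i
  have hproj : LinearMap.IsProj (End.eigenspace a μ) P := by
    constructor
    · intro v
      rw [End.mem_eigenspace_iff]
      have h1 : a * P = μ • P := by
        simp only [P, mul_smul_comm, Finset.mul_sum]
        rw [smul_comm μ]
        congr 1
        have h2 : ∀ i, a * a ^ i = a ^ (i + 1) := fun i => (pow_succ' a i).symm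
        simp only [h2]
        have h3 : ∀ i, μ⁻¹ ^ i • a ^ (i + 1) = μ • (μ⁻¹ ^ (i + 1) • a ^ (i + 1)) := by
          intro i
          rw [smul_smul]
          congr 1
          rw [pow_succ']
          field_simp
        simp only [h3]
        rw [← Finset.smul_sum]
        congr 1
        have h4 := Finset.sum_range_succ (fun i => μ⁻¹ ^ i • a ^ i) p
        rw [Finset.sum_range_succ', hap, smul_smul, ← hμ, ← mul_pow, inv_mul_cancel₀ hμ0, one_pow,
          pow_zero, pow_zero] at h4
        exact add_right_cancel h4
      exact LinearMap.congr_fun h1 v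
    · intro v hv
      rw [End.mem_eigenspace_iff] at hv
      have h1 : ∀ i, (a ^ i) v = μ ^ i • v := by
        intro i
        induction i with
        | zero => simp
        | succ i ih => rw [pow_succ, Module.End.mul_apply, hv, map_smul, ih, smul_smul, pow_succ']
      simp only [P, LinearMap.smul_apply, LinearMap.sum_apply, h1, smul_smul]
      simp only [← mul_pow, inv_mul_cancel₀ hμ0, one_pow, one_smul, Finset.sum_const,
        Finset.card_range]
      rw [← Nat.cast_smul_eq_nsmul ℂ, smul_smul, inv_mul_cancel₀ hp0, one_smul]
  have h1 := trace_eq_finrank_of_isProj hproj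
  simp only [P, map_smul, map_sum, smul_eq_mul] at h1
  rw [Finset.sum_eq_single 0] at h1
  · rw [pow_zero, pow_zero, one_mul, LinearMap.trace_one] at h1
    have h2 : (finrank ℂ V : ℂ) = p * finrank ℂ (End.eigenspace a μ) := by
      rw [← h1]; field_simp
    exact_mod_cast h2
  · intro i hi hi0
    rw [htr i (Nat.pos_of_ne_zero hi0) (Finset.mem_range.1 hi), mul_zero]
  · intro h0
    exact absurd (Finset.mem_range.2 hp) h0

/-- The first pair shows that some eigenspace of `a` has dimension `dim V / p`. The second pair
commutes with `a`, so it acts there, and `p` divides this dimension too. -/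
theorem sq_dvd_finrank [FiniteDimensional ℂ V] {p : ℕ} (hp : 0 < p) {ω ω' κ : ℂ} (hω : IsPrimitiveRoot ω p)
    (hω' : IsPrimitiveRoot ω' p) {a b c d : End ℂ V} (hb : Function.Injective b)
    (hc : Function.Injective c) (hd : Function.Injective d)
    (h : a * b = ω • (b * a)) (h' : c * d = ω' • (d * c)) (hac : a * c = c * a)
    (had : a * d = d * a) (hκ : κ ≠ 0) (hap : a ^ p = κ • 1) :
    p ^ 2 ∣ finrank ℂ V := by
  obtain ⟨μ, hμ⟩ := exists_finrank_eq_mul_finrank_eigenspace hp hω hb h hκ hap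
  rw [hμ, sq]
  refine Nat.mul_dvd_mul_left p ?_
  have hmaps : ∀ f : End ℂ V, a * f = f * a →
      ∀ v ∈ End.eigenspace a μ, f v ∈ End.eigenspace a μ := by
    intro f hf v hv
    rw [End.mem_eigenspace_iff] at hv ⊢
    rw [← Module.End.mul_apply, hf, Module.End.mul_apply, hv, map_smul]
  refine dvd_finrank_of_mul_eq_smul hω' (a := c.restrict (hmaps c hac))
    (b := d.restrict (hmaps d had)) ?_ ?_ ?_
  · intro v w hvw
    exact Subtype.ext (hc (congrArg Subtype.val hvw))
  · intro v w hvw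
    exact Subtype.ext (hd (congrArg Subtype.val hvw))
  · ext v
    exact LinearMap.congr_fun h' v

theorem exists_circle_pow_eq {n : ℕ} (hn : n ≠ 0) (w : Circle) : ∃ c : Circle, c ^ n = w := by
  refine ⟨Circle.exp (Complex.arg w / n), ?_⟩
  have hn' : (n : ℝ) ≠ 0 := Nat.cast_ne_zero.2 hn
  rw [← Circle.exp_nsmul, nsmul_eq_mul, mul_div_cancel₀ _ hn', Circle.exp_arg]

theorem exists_smul_mem_specialUnitaryGroup {n : ℕ} (hn : n ≠ 0) {U : Matrix (Fin n) (Fin n) ℂ}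
    (hU : U ∈ Matrix.unitaryGroup (Fin n) ℂ) :
    ∃ c : Circle, (c : ℂ) ^ n * U.det = 1 ∧ (c : ℂ) • U ∈ Matrix.specialUnitaryGroup (Fin n) ℂ := by
  obtain ⟨w, hw⟩ : ∃ w : Circle, (w : ℂ) = U.det := by
    refine ⟨⟨U.det, mem_sphere_zero_iff_norm.2 ?_⟩, rfl⟩
    exact CStarRing.norm_of_mem_unitary (Matrix.det_of_mem_unitary hU)
  obtain ⟨c, hc⟩ := exists_circle_pow_eq hn w⁻¹
  have h1 : (c : ℂ) ^ n * U.det = 1 := by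
    rw [← hw, ← Circle.coe_pow, hc, ← Circle.coe_mul, inv_mul_cancel, Circle.coe_one]
  refine ⟨c, h1, ?_⟩
  rw [Matrix.mem_specialUnitaryGroup_iff]
  constructor
  · rw [Matrix.mem_unitaryGroup_iff] at hU ⊢
    rw [star_smul, smul_mul_smul_comm, hU]
    have : (c : ℂ) * star (c : ℂ) = 1 := by
      have h2 : star (c : ℂ) = (c : ℂ)⁻¹ := by
        rw [← Circle.coe_inv, Circle.coe_inv_eq_conj]; rfl
      rw [h2, mul_inv_cancel₀ c.coe_ne_zero]
    rw [this, one_smul]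
  · rw [Matrix.det_smul, Fintype.card_fin, h1]

/-- The clock and shift matrices in `SU(p)`. -/
theorem exists_clock_shift {p : ℕ} (hp : 2 ≤ p) : ∃ (A B : SU p) (z : Circle) (e : ℕ),
    IsPrimitiveRoot (z : ℂ) p ∧
    (A : Matrix (Fin p) (Fin p) ℂ) * B = (z : ℂ) • ((B : Matrix (Fin p) (Fin p) ℂ) * A) ∧
    (A : Matrix (Fin p) (Fin p) ℂ) ^ p = (z : ℂ) ^ e • 1 := by
  have hp0 : p ≠ 0 := by omega
  have : NeZero p := ⟨hp0⟩
  obtain ⟨z, hz⟩ : ∃ z : Circle, IsPrimitiveRoot (z : ℂ) p := by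
    refine ⟨Circle.exp (2 * Real.pi / p), ?_⟩
    have := Complex.isPrimitiveRoot_exp p hp0
    rw [Circle.coe_exp]
    convert this using 2
    push_cast
    ring
  let u : Fin p → ℂ := fun i => ((z⁻¹ : Circle) : ℂ) ^ (i : ℕ)
  let σ : Equiv.Perm (Fin p) := Equiv.addRight 1
  let A₀ : Matrix (Fin p) (Fin p) ℂ := Matrix.diagonal u
  let B₀ : Matrix (Fin p) (Fin p) ℂ := σ.permMatrix ℂ
  have hzp : ((z⁻¹ : Circle) : ℂ) ^ p = 1 := by
    rw [Circle.coe_inv, inv_pow, hz.pow_eq_one, inv_one]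
  have hu : ∀ i, u (σ i) = ((z⁻¹ : Circle) : ℂ) * u i := by
    intro i
    have h1 : ((σ i : Fin p) : ℕ) = ((i : ℕ) + 1) % p := by
      simp only [σ, Equiv.coe_addRight, Fin.val_add, Fin.val_one']
      rw [Nat.add_mod_mod]
    simp only [u, h1]
    rw [← pow_succ']
    conv_rhs => rw [← Nat.div_add_mod ((i : ℕ) + 1) p, pow_add, pow_mul, hzp, one_pow, one_mul]
  have hA₀ : A₀ ∈ Matrix.unitaryGroup (Fin p) ℂ := by
    rw [Matrix.mem_unitaryGroup_iff, Matrix.star_eq_conjTranspose, Matrix.diagonal_conjTranspose,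
      Matrix.diagonal_mul_diagonal, ← Matrix.diagonal_one]
    congr 1
    ext i
    have h2 : star ((z⁻¹ : Circle) : ℂ) = z := by
      rw [Circle.coe_inv_eq_conj]; simp
    simp only [u, Pi.star_apply, star_pow, h2, ← mul_pow, ← Circle.coe_mul, inv_mul_cancel,
      Circle.coe_one, one_pow]
  have hB₀ : B₀ ∈ Matrix.unitaryGroup (Fin p) ℂ := by
    rw [Matrix.mem_unitaryGroup_iff, Matrix.star_eq_conjTranspose,
      Matrix.conjTranspose_permMatrix, ← Matrix.permMatrix_mul, inv_mul_cancel, Matrix.permMatrix_one]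
  have hAB₀ : A₀ * B₀ = (z : ℂ) • (B₀ * A₀) := by
    ext i j
    simp only [A₀, B₀, Matrix.diagonal_mul, Matrix.smul_apply, Matrix.mul_diagonal,
      Equiv.Perm.permMatrix, PEquiv.toMatrix_apply, smul_eq_mul, Equiv.toPEquiv_apply,
      Option.mem_def, Option.some.injEq]
    split_ifs with h
    · rw [← h, hu, Circle.coe_inv]
      field_simp [z.coe_ne_zero]
    · simp
  obtain ⟨c, hc, hcA⟩ := exists_smul_mem_specialUnitaryGroup hp0 hA₀
  obtain ⟨c', -, hcB⟩ := exists_smul_mem_specialUnitaryGroup hp0 hB₀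
  have hA₀p : A₀ ^ p = 1 := by
    rw [Matrix.diagonal_pow, ← Matrix.diagonal_one]
    congr 1
    ext i
    simp only [u, Pi.pow_apply]
    rw [← pow_mul, mul_comm, pow_mul, hzp, one_pow]
  -- The clock matrix can have determinant `-1` (when `p` is even), so the rescaling into `SU(p)`
  -- may spoil `A ^ p = 1`. What survives is a power of `z`, that is, a central element of `SU(p)`.
  obtain ⟨e, -, he⟩ := hz.eq_pow_of_pow_eq_one (ξ := (c : ℂ) ^ p) (by
    have h1 : A₀.det ^ p = 1 := by rw [← Matrix.det_pow, hA₀p, Matrix.det_one]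
    have h2 := congrArg (· ^ p) hc
    simpa only [mul_pow, h1, mul_one, one_pow] using h2)
  refine ⟨⟨_, hcA⟩, ⟨_, hcB⟩, z, e, hz, ?_, ?_⟩
  · simp only [smul_mul_smul_comm, hAB₀]
    rw [smul_comm, mul_comm]
  · simp only [smul_pow, hA₀p, he]

end Heisenberg

/-! ### The congruence for sums of squares of weights. -/

section Arithmetic

/-- Split the sum by residue `k` of `d`. For `k ≠ 0`, write `d² = k² + (d² - k²)`: the first part
has a class sum divisible by `p²`, the second has one factor `p` from `d² - k²` and one from `m d`.
-/
theorem sq_dvd_sum_sq_mul {p : ℕ} [Fact p.Prime] (C : Finset ℤ) (m : ℤ → ℤ)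
    (h1 : ∀ d ∈ C, ¬ (p : ℤ) ∣ d → (p : ℤ) ∣ m d)
    (h2 : ∀ k : ZMod p, k ≠ 0 → (p : ℤ) ^ 2 ∣ ∑ d ∈ C.filter (fun d : ℤ => (d : ZMod p) = k), m d) :
    (p : ℤ) ^ 2 ∣ ∑ d ∈ C, d ^ 2 * m d := by
  rw [← Finset.sum_fiberwise C (fun d : ℤ => (d : ZMod p))]
  refine Finset.dvd_sum fun k _ => ?_
  by_cases hk : k = 0
  · refine Finset.dvd_sum fun d hd => Dvd.dvd.mul_right (pow_dvd_pow_of_dvd ?_ 2) _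
    rw [← ZMod.intCast_zmod_eq_zero_iff_dvd, (Finset.mem_filter.1 hd).2, hk]
  · have h3 : ∑ d ∈ C.filter (fun d : ℤ => (d : ZMod p) = k), d ^ 2 * m d =
        (k.val : ℤ) ^ 2 * (∑ d ∈ C.filter (fun d : ℤ => (d : ZMod p) = k), m d) +
        ∑ d ∈ C.filter (fun d : ℤ => (d : ZMod p) = k), (d ^ 2 - (k.val : ℤ) ^ 2) * m d := by
      rw [Finset.mul_sum, ← Finset.sum_add_distrib]
      exact Finset.sum_congr rfl fun d _ => by ring
    rw [h3]
    refine dvd_add ((h2 k hk).mul_left _) (Finset.dvd_sum fun d hd => ?_)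
    obtain ⟨hdC, hdk⟩ := Finset.mem_filter.1 hd
    rw [sq (p : ℤ)]
    refine mul_dvd_mul ?_ (h1 d hdC fun h => hk ?_)
    · rw [← ZMod.intCast_zmod_eq_zero_iff_dvd]
      push_cast
      rw [hdk, ZMod.natCast_zmod_val, sub_self]
    · rw [← hdk, ZMod.intCast_zmod_eq_zero_iff_dvd]
      exact h

end Arithmetic

/-! ### Moments of spaces carrying two commuting Heisenberg pairs. -/

section Divisibility

variable {X : Type*}

theorem mem_suppOn_iff_diagonal_mulVec [Fintype X] [DecidableEq X] {f : X → ℂ} {c : ℂ} {v : X → ℂ} :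
    v ∈ suppOn {x | f x = c} ↔ (Matrix.diagonal f).mulVec v = c • v := by
  constructor
  · intro h
    ext x
    rw [Matrix.mulVec_diagonal, Pi.smul_apply, smul_eq_mul]
    by_cases hx : f x = c
    · rw [hx]
    · rw [h x hx, mul_zero, mul_zero]
  · intro h x hx
    have h1 := congrFun h x
    rw [Matrix.mulVec_diagonal, Pi.smul_apply, smul_eq_mul] at h1
    by_contra hv
    exact hx (mul_right_cancel₀ hv h1)

theorem mulVec_mem_suppOn_of_commute [Fintype X] [DecidableEq X]
    {T : Matrix X X ℂ} {f : X → ℂ}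
    (h : Commute T (Matrix.diagonal f)) {c : ℂ} {v : X → ℂ} (hv : v ∈ suppOn {x | f x = c}) :
    T.mulVec v ∈ suppOn {x | f x = c} := by
  rw [mem_suppOn_iff_diagonal_mulVec] at hv ⊢
  rw [Matrix.mulVec_mulVec, ← h.eq, ← Matrix.mulVec_mulVec, hv, Matrix.mulVec_smul]

theorem setOf_eq_setOf_zpow_circle (φ : X → ℤ) (d : ℤ) :
    {x | φ x = d} = {x | ((Circle.exp 1 : Circle) : ℂ) ^ φ x = ((Circle.exp 1 : Circle) : ℂ) ^ d} :=
  Set.ext fun _ => zpow_circle_exp_one_injective.eq_iff.symm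

theorem zpow_eq_zpow_iff_cast {p : ℕ} {z : ℂ} (hp : 0 < p) (hz : IsPrimitiveRoot z p) (a b : ℤ) :
    z ^ a = z ^ b ↔ (a : ZMod p) = b := by
  have hz0 : z ≠ 0 := hz.ne_zero hp.ne'
  rw [ZMod.intCast_eq_intCast_iff_dvd_sub, ← hz.zpow_eq_one_iff_dvd, zpow_sub₀ hz0,
    div_eq_one_iff_eq (zpow_ne_zero _ hz0), eq_comm]

/-- Suppose that a graded subspace is stable under two commuting pairs `(aL, bL)` and `(aR, bR)` of
operators, each of which generates a Heisenberg group, and that the sum of the central charges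
vanishes. Then the sum of the squares of weights that are congruent to the central charge of
`(aL, bL)` is divisible by `p ^ 2`. -/
theorem sq_dvd_moment [Fintype X] [DecidableEq X]
    {p : ℕ} [hp : Fact p.Prime] {z : Circle} (hz : IsPrimitiveRoot (z : ℂ) p)
    {φ νL νR : X → ℤ} {aL bL aR bR : Matrix X X ℂ} {W : Submodule ℂ (X → ℂ)} {e : ℕ}
    (hW : ∀ T ∈ ({aL, bL, aR, bR} : Set (Matrix X X ℂ)), ∀ w ∈ W, T.mulVec w ∈ W)
    (hinj : ∀ T ∈ ({bL, aR, bR} : Set (Matrix X X ℂ)), Function.Injective T.mulVec)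
    (hL : aL * bL = Matrix.diagonal (fun x => (z : ℂ) ^ νL x) * (bL * aL))
    (hR : aR * bR = Matrix.diagonal (fun x => (z : ℂ) ^ νR x) * (bR * aR))
    (haa : aL * aR = aR * aL) (hab : aL * bR = bR * aL)
    (hLp : aL ^ p = Matrix.diagonal (fun x => (z : ℂ) ^ νL x) ^ e)
    (hν : ∀ T ∈ ({aL, bL, aR, bR} : Set (Matrix X X ℂ)),
      Commute T (Matrix.diagonal (fun x => (z : ℂ) ^ νL x)))
    (hφ : ∀ T ∈ ({aR, bR} : Set (Matrix X X ℂ)), ∀ y : Circle,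
      Commute T (Matrix.diagonal (fun x => (y : ℂ) ^ φ x)))
    (hφν : ∀ x, (φ x : ZMod p) = νL x) (hWν : W ≤ suppOn {x | ((νL x + νR x : ℤ) : ZMod p) = 0})
    (hgr : IsGraded W φ) (C : Finset ℤ) (hC : ∀ x, φ x ∈ C) :
    (p : ℤ) ^ 2 ∣ moment W φ C := by
  have hp0 := hp.1.pos
  -- The vectors of left central charge `k`; by `hWν` their right central charge is `-k`, which is
  -- where the inverse in `hER` comes from.
  let E : ZMod p → Submodule ℂ (X → ℂ) := fun k => W ⊓ suppOn {x | (φ x : ZMod p) = k}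
  have hset : ∀ k : ZMod p, {x | (φ x : ZMod p) = k} =
      {x | (z : ℂ) ^ νL x = (z : ℂ) ^ (k.val : ℤ)} := fun k => by
    ext x
    simp only [Set.mem_ofPred_eq]
    rw [zpow_eq_zpow_iff_cast hp0 hz, hφν]
    simp
  have hEL : ∀ k, ∀ v ∈ E k,
      (Matrix.diagonal fun x => (z : ℂ) ^ νL x).mulVec v = (z : ℂ) ^ (k.val : ℤ) • v := by
    intro k v hv
    rw [← mem_suppOn_iff_diagonal_mulVec, ← hset]
    exact hv.2
  have hER : ∀ k, ∀ v ∈ E k,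
      (Matrix.diagonal fun x => (z : ℂ) ^ νR x).mulVec v = ((z : ℂ) ^ (k.val : ℤ))⁻¹ • v := by
    intro k v hv
    ext x
    rw [Matrix.mulVec_diagonal, Pi.smul_apply, smul_eq_mul]
    by_cases hx : v x = 0
    · rw [hx, mul_zero, mul_zero]
    · congr 1
      have h1 : (φ x : ZMod p) = k := by
        by_contra h; exact hx (hv.2 x h)
      have h2 : ((νL x + νR x : ℤ) : ZMod p) = 0 := by
        by_contra h; exact hx (hWν hv.1 x h)
      rw [← zpow_neg, zpow_eq_zpow_iff_cast hp0 hz]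
      push_cast at h2 ⊢
      rw [ZMod.natCast_zmod_val, ← h1, hφν]
      linear_combination h2
  have hEmaps : ∀ T ∈ ({aL, bL, aR, bR} : Set (Matrix X X ℂ)), ∀ k, ∀ v ∈ E k,
      T.mulVecLin v ∈ E k := by
    intro T hT k v hv
    refine ⟨hW T hT v hv.1, ?_⟩
    have := hv.2
    rw [hset] at this ⊢
    exact mulVec_mem_suppOn_of_commute (hν T hT) this
  have hroot : ∀ k : ZMod p, k ≠ 0 → IsPrimitiveRoot ((z : ℂ) ^ (k.val : ℤ)) p := by
    intro k hk
    rw [zpow_natCast]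
    refine hz.pow_of_coprime _ (Nat.Coprime.symm ((Nat.Prime.coprime_iff_not_dvd hp.1).2 ?_))
    intro h
    rw [← ZMod.natCast_eq_zero_iff, ZMod.natCast_zmod_val] at h
    exact hk h
  have hrelR : ∀ k, ∀ v ∈ E k, aR.mulVec (bR.mulVec v) =
      ((z : ℂ) ^ (k.val : ℤ))⁻¹ • bR.mulVec (aR.mulVec v) := by
    intro k v hv
    rw [Matrix.mulVec_mulVec, hR, ← Matrix.mulVec_mulVec, ← Matrix.mulVec_mulVec, hER k]
    exact hEmaps bR (by simp) k _ (hEmaps aR (by simp) k _ hv)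
  have hrelL : ∀ k, ∀ v ∈ E k, aL.mulVec (bL.mulVec v) =
      (z : ℂ) ^ (k.val : ℤ) • bL.mulVec (aL.mulVec v) := by
    intro k v hv
    rw [Matrix.mulVec_mulVec, hL, ← Matrix.mulVec_mulVec, ← Matrix.mulVec_mulVec, hEL k]
    exact hEmaps bL (by simp) k _ (hEmaps aL (by simp) k _ hv)
  refine sq_dvd_sum_sq_mul C _ (fun d _ hd => ?_) (fun k hk => ?_)
  -- The right pair commutes with the left torus, so it acts on the single weight space of weight
  -- `d`, with central character of order `p`.
  · let k : ZMod p := d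
    have hk : k ≠ 0 := fun h => hd ((ZMod.intCast_zmod_eq_zero_iff_dvd d p).1 h)
    let M : Submodule ℂ (X → ℂ) := W ⊓ suppOn {x | φ x = d}
    have hME : M ≤ E k := fun v hv => ⟨hv.1, fun x hx => hv.2 x fun h => hx (by
      change (φ x : ZMod p) = (d : ZMod p)
      rw [show φ x = d from h])⟩
    have hM : ∀ T ∈ ({aR, bR} : Set (Matrix X X ℂ)), ∀ v ∈ M, T.mulVecLin v ∈ M := by
      intro T hT v hv
      refine ⟨hW T (by rcases hT with h | h <;> simp_all) v hv.1, ?_⟩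
      have := hv.2
      rw [setOf_eq_setOf_zpow_circle] at this ⊢
      exact mulVec_mem_suppOn_of_commute (hφ T hT _) this
    refine Int.natCast_dvd_natCast.2 (dvd_finrank_of_mul_eq_smul (hroot k hk).inv
      (a := aR.mulVecLin.restrict (hM aR (by simp))) (b := bR.mulVecLin.restrict (hM bR (by simp)))
      ?_ ?_ ?_)
    · intro v w hvw
      exact Subtype.ext (hinj aR (by simp) (congrArg Subtype.val hvw))
    · intro v w hvw
      exact Subtype.ext (hinj bR (by simp) (congrArg Subtype.val hvw))
    · refine LinearMap.ext fun v => Subtype.ext ?_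
      exact hrelR k v (hME v.2)
  -- The left pair may change the weight, but not its residue. Hence both pairs act on the whole
  -- class `E k`, to which `sq_dvd_finrank` applies.
  · have hsum : ((Module.finrank ℂ (E k) : ℕ) : ℤ) =
        ∑ d ∈ C.filter (fun d : ℤ => (d : ZMod p) = k),
          (Module.finrank ℂ (W ⊓ suppOn {x | φ x = d} : Submodule ℂ (X → ℂ)) : ℤ) := by
      rw [finrank_eq_sum_finrank (hgr.inf_suppOn {x | (φ x : ZMod p) = k}) C hC, Nat.cast_sum,
        Finset.sum_filter]
      refine Finset.sum_congr rfl fun d _ => ?_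
      split_ifs with h
      · have hE : W ⊓ suppOn {x | (φ x : ZMod p) = k} ⊓ suppOn {x | φ x = d} =
            W ⊓ suppOn {x | φ x = d} := by
          ext v
          refine ⟨fun hv => ⟨hv.1.1, hv.2⟩, fun hv => ⟨⟨hv.1, fun x hx => hv.2 x fun h' => hx ?_⟩, hv.2⟩⟩
          rw [← h, ← show φ x = d from h']
          rfl
        rw [hE]
      · rw [Nat.cast_eq_zero, Submodule.finrank_eq_zero, Submodule.eq_bot_iff]
        intro v hv
        ext x
        by_contra hx
        have h1 : φ x = d := by
          by_contra h'; exact hx (hv.2 x h')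
        have h2 : (φ x : ZMod p) = k := by
          by_contra h'; exact hx (hv.1.2 x h')
        exact h (by rw [← h1, h2])
    rw [← hsum]
    have hm := fun T hT => hEmaps T hT k
    have := sq_dvd_finrank hp0 (hroot k hk) (hroot k hk).inv
      (a := aL.mulVecLin.restrict (hm aL (by simp))) (b := bL.mulVecLin.restrict (hm bL (by simp)))
      (c := aR.mulVecLin.restrict (hm aR (by simp))) (d := bR.mulVecLin.restrict (hm bR (by simp)))
      (κ := ((z : ℂ) ^ (k.val : ℤ)) ^ e) ?_ ?_ ?_ ?_ ?_ ?_ ?_ ?_ ?_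
    · exact_mod_cast Int.natCast_dvd_natCast.2 this
    · intro v w hvw
      exact Subtype.ext (hinj bL (by simp) (congrArg Subtype.val hvw))
    · intro v w hvw
      exact Subtype.ext (hinj aR (by simp) (congrArg Subtype.val hvw))
    · intro v w hvw
      exact Subtype.ext (hinj bR (by simp) (congrArg Subtype.val hvw))
    · exact LinearMap.ext fun v => Subtype.ext (hrelL k v v.2)
    · exact LinearMap.ext fun v => Subtype.ext (hrelR k v v.2)
    · refine LinearMap.ext fun v => Subtype.ext ?_
      change aL.mulVec (aR.mulVec v) = aR.mulVec (aL.mulVec v)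
      rw [Matrix.mulVec_mulVec, haa, Matrix.mulVec_mulVec]
    · refine LinearMap.ext fun v => Subtype.ext ?_
      change aL.mulVec (bR.mulVec v) = bR.mulVec (aL.mulVec v)
      rw [Matrix.mulVec_mulVec, hab, Matrix.mulVec_mulVec]
    · exact pow_ne_zero _ (zpow_ne_zero _ z.coe_ne_zero)
    · refine LinearMap.ext fun v => Subtype.ext ?_
      have h1 : ∀ n : ℕ, (((aL.mulVecLin.restrict (hm aL (by simp))) ^ n) v : X → ℂ) =
          (aL ^ n).mulVec v := by
        intro n
        induction n with
        | zero => simp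
        | succ n ih =>
          rw [pow_succ', Module.End.mul_apply, pow_succ', ← Matrix.mulVec_mulVec, ← ih]
          rfl
      have h2 : ∀ n : ℕ, ((Matrix.diagonal fun x => (z : ℂ) ^ νL x) ^ n).mulVec (v : X → ℂ) =
          ((z : ℂ) ^ (k.val : ℤ)) ^ n • (v : X → ℂ) := by
        intro n
        induction n with
        | zero => simp
        | succ n ih =>
          rw [pow_succ, ← Matrix.mulVec_mulVec, hEL k v v.2, Matrix.mulVec_smul, ih, smul_smul,
            pow_succ']
      rw [h1, hLp, h2]
      rfl

end Divisibility

/-! ### The clock and shift matrices of the last `p` flavors acting on tensors. -/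

section Embedding

variable {n h m : ℕ}

/-- The tensor action of a pair of matrices on the left- and right-handed quarks. -/
def pairMat (nq na : ℕ) (U V : Matrix (Fin n) (Fin n) ℂ) :
    Matrix ((Fin nq → Fin n ⊕ Fin n) × (Fin na → Fin n ⊕ Fin n))
      ((Fin nq → Fin n ⊕ Fin n) × (Fin na → Fin n ⊕ Fin n)) ℂ :=
  constituentMat (Matrix.fromBlocks U 0 0 V) nq na

theorem pairMat_mul (nq na : ℕ) (U V U' V' : Matrix (Fin n) (Fin n) ℂ) :
    pairMat nq na U V * pairMat nq na U' V' = pairMat nq na (U * U') (V * V') := by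
  rw [pairMat, pairMat, ← constituentMat_mul, Matrix.fromBlocks_multiply]
  simp [pairMat]

theorem pairMat_one (nq na : ℕ) : pairMat nq na (1 : Matrix (Fin n) (Fin n) ℂ) 1 = 1 := by
  rw [pairMat, Matrix.fromBlocks_one, constituentMat_one]

theorem pairMat_pow (nq na : ℕ) (U : Matrix (Fin n) (Fin n) ℂ) (k : ℕ) :
    pairMat nq na U 1 ^ k = pairMat nq na (U ^ k) 1 := by
  induction k with
  | zero => rw [pow_zero, pow_zero, pairMat_one]
  | succ k ih => rw [pow_succ, ih, pairMat_mul, pow_succ, one_mul]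

theorem conjTranspose_pairMat (nq na : ℕ) (U V : Matrix (Fin n) (Fin n) ℂ) :
    (pairMat nq na U V).conjTranspose = pairMat nq na U.conjTranspose V.conjTranspose := by
  rw [pairMat, conjTranspose_constituentMat, Matrix.fromBlocks_conjTranspose]
  simp [pairMat]

theorem constituentMat_quarkMat (nq na : ℕ) (gL gR : SU n) (w : Circle) :
    constituentMat (quarkMat gL gR w) nq na =
      pairMat nq na ((w : ℂ) • (gL : Matrix (Fin n) (Fin n) ℂ))
        ((w : ℂ) • (gR : Matrix (Fin n) (Fin n) ℂ)) := by
  rw [quarkMat, Matrix.fromBlocks_smul, smul_zero, pairMat]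

theorem pairMat_diagonal_zpow (nq na : ℕ) (f g : Fin n → ℤ) (z : Circle) :
    pairMat nq na (Matrix.diagonal fun i => (z : ℂ) ^ f i) (Matrix.diagonal fun i => (z : ℂ) ^ g i) =
      Matrix.diagonal fun x => (z : ℂ) ^ charge (Sum.elim f g) x := by
  rw [← constituentMat_diagonal_zpow, pairMat, Matrix.fromBlocks_diagonal]
  congr 2
  ext (i | i) <;> rfl

theorem pairMat_diagonal_zpow_left (nq na : ℕ) (f : Fin n → ℤ) (z : Circle) :
    pairMat nq na (Matrix.diagonal fun i => (z : ℂ) ^ f i) 1 =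
      Matrix.diagonal fun x => (z : ℂ) ^ charge (Sum.elim f 0) x := by
  rw [← pairMat_diagonal_zpow]
  simp

theorem pairMat_diagonal_zpow_right (nq na : ℕ) (f : Fin n → ℤ) (z : Circle) :
    pairMat nq na 1 (Matrix.diagonal fun i => (z : ℂ) ^ f i) =
      Matrix.diagonal fun x => (z : ℂ) ^ charge (Sum.elim 0 f) x := by
  rw [← pairMat_diagonal_zpow]
  simp

/-- The embedding of matrices that act on the last `m` flavors. -/
def embedMat (e : h + m = n) (u : Matrix (Fin m) (Fin m) ℂ) : Matrix (Fin n) (Fin n) ℂ :=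
  Matrix.reindex (flavorSplit e) (flavorSplit e) (Matrix.fromBlocks 1 0 0 u)

theorem embedMat_mul (e : h + m = n) (u v : Matrix (Fin m) (Fin m) ℂ) :
    embedMat e (u * v) = embedMat e u * embedMat e v := by
  simp only [embedMat, Matrix.reindex_apply, Matrix.submatrix_mul_equiv, Matrix.fromBlocks_multiply]
  simp

theorem embedMat_one (e : h + m = n) : embedMat e 1 = 1 := by
  simp [embedMat, Matrix.fromBlocks_one]

theorem embedMat_pow (e : h + m = n) (u : Matrix (Fin m) (Fin m) ℂ) (k : ℕ) :
    embedMat e (u ^ k) = embedMat e u ^ k := by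
  induction k with
  | zero => rw [pow_zero, pow_zero, embedMat_one]
  | succ k ih => rw [pow_succ, embedMat_mul, ih, pow_succ]

theorem continuous_embedMat (e : h + m = n) : Continuous (embedMat e) := by
  refine Continuous.matrix_reindex ?_ _ _
  exact Continuous.matrix_fromBlocks continuous_const continuous_const continuous_const continuous_id

theorem embedMat_diagonal (e : h + m = n) (d : Fin m → ℂ) :
    embedMat e (Matrix.diagonal d) =
      Matrix.diagonal (Sum.elim 1 d ∘ (flavorSplit e).symm) := by
  rw [embedMat, ← Matrix.diagonal_one, Matrix.fromBlocks_diagonal, Matrix.reindex_apply,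
    Matrix.submatrix_diagonal_equiv]
  rfl

/-- The indicator function of the last `m` flavors. -/
def lastFlavors (e : h + m = n) : Fin n → ℤ := Sum.elim 0 1 ∘ (flavorSplit e).symm

theorem embedMat_scalar (e : h + m = n) (z : Circle) :
    embedMat e ((z : ℂ) • 1) = Matrix.diagonal fun i => (z : ℂ) ^ lastFlavors e i := by
  rw [← Matrix.diagonal_one, ← Matrix.diagonal_smul, embedMat_diagonal]
  congr 1
  ext i
  simp only [Function.comp_apply, lastFlavors]
  rcases (flavorSplit e).symm i with j | j <;> simp

theorem coe_flavorSplit_inl (e : h + m = n) (i : Fin h) :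
    ((flavorSplit e (Sum.inl i) : Fin n) : ℕ) = i := by
  simp [flavorSplit]

/-- The contributions of the gauged weights to the second moment are divisible by `p ^ 2` on tensors
on which the center of `SU(p)` acts trivially. -/
theorem sq_dvd_moment_of_invariant {p : ℕ} [hp : Fact p.Prime] (e : h + p = n) {nq na : ℕ}
    {W : Submodule ℂ ((Fin nq → Fin n ⊕ Fin n) × (Fin na → Fin n ⊕ Fin n) → ℂ)}
    (hW : ∀ u v : SU p, ∀ w ∈ W, (pairMat nq na (embedMat e u) (embedMat e v)).mulVec w ∈ W)
    (f : Fin n → ℤ) (hf : ∀ i, (f i : ZMod p) = lastFlavors e i)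
    (hWν : W ≤ suppOn {x | ((charge (Sum.elim (lastFlavors e) (lastFlavors e)) x : ℤ) : ZMod p) = 0})
    (hgr : IsGraded W (charge (Sum.elim f 0))) (C : Finset ℤ)
    (hC : ∀ x : (Fin nq → Fin n ⊕ Fin n) × (Fin na → Fin n ⊕ Fin n), charge (Sum.elim f 0) x ∈ C) :
    (p : ℤ) ^ 2 ∣ moment W (charge (Sum.elim f 0)) C := by
  obtain ⟨A, B, z, s, hz, hAB, hAp⟩ := exists_clock_shift hp.1.two_le
  have hinj : ∀ U V : SU p,
      Function.Injective (pairMat nq na (embedMat e U) (embedMat e V)).mulVec := by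
    intro U V v w hvw
    have h1 := congrArg (pairMat nq na (embedMat e (U⁻¹ : SU p)) (embedMat e (V⁻¹ : SU p))).mulVec hvw
    have h2 : ∀ U : SU p, ((U⁻¹ : SU p) : Matrix (Fin p) (Fin p) ℂ) * U = 1 := fun U =>
      congrArg Subtype.val (inv_mul_cancel U)
    rw [Matrix.mulVec_mulVec, Matrix.mulVec_mulVec, pairMat_mul, ← embedMat_mul, ← embedMat_mul,
      h2, h2, embedMat_one, pairMat_one, Matrix.one_mulVec, Matrix.one_mulVec] at h1
    exact h1
  have hsmul : ∀ M : Matrix (Fin p) (Fin p) ℂ, embedMat e ((z : ℂ) • M) =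
      (Matrix.diagonal fun i => (z : ℂ) ^ lastFlavors e i) * embedMat e M := by
    intro M
    rw [← embedMat_scalar, ← embedMat_mul, smul_one_mul]
  have hcomm : ∀ M : Matrix (Fin p) (Fin p) ℂ,
      embedMat e M * (Matrix.diagonal fun i => (z : ℂ) ^ lastFlavors e i) =
      (Matrix.diagonal fun i => (z : ℂ) ^ lastFlavors e i) * embedMat e M := by
    intro M
    rw [← embedMat_scalar, ← embedMat_mul, ← embedMat_mul, smul_one_mul, mul_smul_one]
  have hone : embedMat e ((1 : SU p) : Matrix (Fin p) (Fin p) ℂ) = 1 := embedMat_one e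
  refine sq_dvd_moment hz (νL := charge (Sum.elim (lastFlavors e) 0))
    (νR := charge (Sum.elim 0 (lastFlavors e))) (aL := pairMat nq na (embedMat e A) 1)
    (bL := pairMat nq na (embedMat e B) 1) (aR := pairMat nq na 1 (embedMat e A))
    (bR := pairMat nq na 1 (embedMat e B)) (e := s) ?_ ?_ ?_ ?_ ?_ ?_ ?_ ?_ ?_ ?_ ?_ hgr C hC
  · rintro T (rfl | rfl | rfl | rfl) w hw
    · have := hW A 1 w hw; rwa [hone] at this
    · have := hW B 1 w hw; rwa [hone] at this
    · have := hW 1 A w hw; rwa [hone] at this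
    · have := hW 1 B w hw; rwa [hone] at this
  · rintro T (rfl | rfl | rfl)
    · have := hinj B 1; rwa [hone] at this
    · have := hinj 1 A; rwa [hone] at this
    · have := hinj 1 B; rwa [hone] at this
  · rw [← pairMat_diagonal_zpow_left, pairMat_mul, pairMat_mul, pairMat_mul, ← embedMat_mul, hAB,
      hsmul, ← embedMat_mul, one_mul, one_mul]
  · rw [← pairMat_diagonal_zpow_right, pairMat_mul, pairMat_mul, pairMat_mul, ← embedMat_mul, hAB,
      hsmul, ← embedMat_mul, one_mul, one_mul]
  · simp only [pairMat_mul, one_mul, mul_one]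
  · simp only [pairMat_mul, one_mul, mul_one]
  · rw [← pairMat_diagonal_zpow_left, pairMat_pow, pairMat_pow, ← embedMat_pow, hAp,
      ← embedMat_scalar, ← embedMat_pow, smul_pow, one_pow]
  · rw [← pairMat_diagonal_zpow_left]
    rintro T (rfl | rfl | rfl | rfl) <;> rw [Commute, SemiconjBy, pairMat_mul, pairMat_mul]
    · rw [hcomm]
    · rw [hcomm]
    · simp only [one_mul, mul_one]
    · simp only [one_mul, mul_one]
  · intro T hT y
    rw [← pairMat_diagonal_zpow_left]
    rcases hT with rfl | rfl <;> rw [Commute, SemiconjBy, pairMat_mul, pairMat_mul]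
    · simp only [one_mul, mul_one]
    · simp only [one_mul, mul_one]
  · intro x
    have : ∀ q : Fin n ⊕ Fin n, ((Sum.elim f 0 q : ℤ) : ZMod p) =
        ((Sum.elim (lastFlavors e) 0 q : ℤ) : ZMod p) := by
      rintro (i | i)
      · exact hf i
      · rfl
    simp only [charge]
    push_cast
    simp only [this]
  -- The left and right central charges add up to the charge that counts the last flavors of both
  -- chiralities.
  · refine hWν.trans fun v hv x hx => hv x fun h' => hx ?_
    have : charge (Sum.elim (lastFlavors e) 0) x + charge (Sum.elim 0 (lastFlavors e)) x =
        charge (Sum.elim (lastFlavors e) (lastFlavors e)) x := by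
      have h2 : ∀ q : Fin n ⊕ Fin n, (Sum.elim (lastFlavors e) (lastFlavors e) q : ℤ) =
          Sum.elim (lastFlavors e) (0 : Fin n → ℤ) q + Sum.elim (0 : Fin n → ℤ) (lastFlavors e) q := by
        rintro (i | i) <;> simp
      simp only [charge, h2, Finset.sum_add_distrib]
      ring
    change ((_ : ℤ) : ZMod p) = 0
    rw [this]
    exact h'

end Embedding

/-! ### Second derivatives of trigonometric polynomials. -/

section Phases

theorem coe_circle_exp_zpow (t : ℝ) (d : ℤ) :
    ((Circle.exp t : Circle) : ℂ) ^ d = Complex.exp ((d * Complex.I) * t) := by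
  rw [Circle.coe_exp, ← Complex.exp_int_mul]
  congr 1
  ring

theorem hasDerivAt_circle_exp_zpow (t : ℝ) (d : ℤ) :
    HasDerivAt (fun t : ℝ => ((Circle.exp t : Circle) : ℂ) ^ d)
      (d * Complex.I * ((Circle.exp t : Circle) : ℂ) ^ d) t := by
  simp only [coe_circle_exp_zpow]
  have h : HasDerivAt (fun t : ℝ => (d * Complex.I : ℂ) * t) (d * Complex.I) t := by
    simpa using (Complex.ofRealCLM.hasDerivAt (x := t)).const_mul (d * Complex.I : ℂ)
  have := h.cexp
  rwa [mul_comm (Complex.exp _)] at this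

theorem deriv_deriv_sum_zpow (C : Finset ℤ) (c : ℤ → ℂ) :
    deriv (deriv fun t : ℝ => ∑ d ∈ C, c d * ((Circle.exp t : Circle) : ℂ) ^ d) 0 =
      -∑ d ∈ C, (d : ℂ) ^ 2 * c d := by
  have h1 : (deriv fun t : ℝ => ∑ d ∈ C, c d * ((Circle.exp t : Circle) : ℂ) ^ d) =
      fun t => ∑ d ∈ C, (c d * (d * Complex.I)) * ((Circle.exp t : Circle) : ℂ) ^ d := by
    ext t
    refine (HasDerivAt.fun_sum fun d _ => (hasDerivAt_circle_exp_zpow t d).const_mul (c d)).deriv.trans ?_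
    exact Finset.sum_congr rfl fun d _ => by ring
  rw [h1]
  refine (HasDerivAt.fun_sum fun d _ =>
    (hasDerivAt_circle_exp_zpow 0 d).const_mul (c d * (d * Complex.I))).deriv.trans ?_
  rw [← Finset.sum_neg_distrib]
  refine Finset.sum_congr rfl fun d _ => ?_
  simp only [Circle.exp_zero, Circle.coe_one, one_zpow, mul_one]
  linear_combination c d * (d : ℂ) ^ 2 * Complex.I_sq

end Phases

/-! ### Multiplets as spaces of tensors, graded by flavor charges. -/

section Composites

variable {n : ℕ} {Nc : ℕ}

/-- A realization of a multiplet as a composite of quarks and antiquarks. -/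
structure Composite (Nc : ℕ) (r : Multiplet n) where
  nq : ℕ
  na : ℕ
  count : (nq : ℤ) - (na : ℤ) = r.baryon * (Nc : ℤ)
  J : (Fin r.L.dim × Fin r.R.dim → ℂ) →ₗ[ℂ]
      ((Fin nq → Fin n ⊕ Fin n) × (Fin na → Fin n ⊕ Fin n) → ℂ)
  inj : Function.Injective J
  map_act : ∀ (gL gR : SU n) (w : Circle) (v : Fin r.L.dim × Fin r.R.dim → ℂ),
    J ((r.act Nc gL gR w).mulVec v) = (constituentMat (quarkMat gL gR w) nq na).mulVec (J v)

theorem Multiplet.IsColorScreened.nonempty_composite {r : Multiplet n}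
    (h : r.IsColorScreened Nc) : Nonempty (Composite Nc r) := by
  obtain ⟨nq, na, hn, J, hJ, hJ'⟩ := h
  exact ⟨⟨nq, na, hn, J, hJ, hJ'⟩⟩

/-- The charge of the quarks that counts the flavor `i`. -/
def flavorCharge (i : Fin n) : Fin n ⊕ Fin n → ℤ := Sum.elim (Pi.single i 1) (Pi.single i 1)

theorem diagonal_update_eq (i : Fin n) (z : Circle) :
    Matrix.diagonal (Function.update (1 : Fin n → ℂ) i (z : ℂ)) =
      Matrix.diagonal fun j => (z : ℂ) ^ (Pi.single i (1 : ℤ) : Fin n → ℤ) j := by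
  congr 1
  ext j
  rcases eq_or_ne j i with rfl | h
  · simp
  · simp [h]

theorem diagonal_zpow_mem_unitaryGroup (f : Fin n → ℤ) (z : Circle) :
    (Matrix.diagonal fun i => (z : ℂ) ^ f i) ∈ Matrix.unitaryGroup (Fin n) ℂ := by
  rw [Matrix.mem_unitaryGroup_iff, Matrix.star_eq_conjTranspose, Matrix.diagonal_conjTranspose,
    Matrix.diagonal_mul_diagonal, ← Matrix.diagonal_one]
  congr 1
  ext i
  have h2 : star (z : ℂ) = (z : ℂ)⁻¹ := by
    rw [← Circle.coe_inv, Circle.coe_inv_eq_conj]; rfl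
  rw [Pi.star_apply, star_zpow₀, h2, inv_zpow, mul_inv_cancel₀ (zpow_ne_zero _ z.coe_ne_zero)]

/-- Rotating one flavor changes the determinant; an `n`-th root of it is moved into the `U(1)_B`
phase `w`. -/
theorem exists_flavor_rotation (i : Fin n) (z : Circle) : ∃ (g : SU n) (w : Circle),
    (w : ℂ) • (g : Matrix (Fin n) (Fin n) ℂ) =
      Matrix.diagonal (Function.update 1 i (z : ℂ)) := by
  obtain ⟨c, -, hc⟩ := exists_smul_mem_specialUnitaryGroup (Nat.ne_of_gt i.pos)
    (diagonal_zpow_mem_unitaryGroup (Pi.single i 1) z)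
  refine ⟨⟨_, hc⟩, c⁻¹, ?_⟩
  rw [diagonal_update_eq, smul_smul, ← Circle.coe_mul, inv_mul_cancel, Circle.coe_one, one_smul]

theorem constituentMat_flavor_rotation {i : Fin n} {z : Circle} {g : SU n} {w : Circle}
    (h : (w : ℂ) • (g : Matrix (Fin n) (Fin n) ℂ) = Matrix.diagonal (Function.update 1 i (z : ℂ)))
    (nq na : ℕ) :
    constituentMat (quarkMat g g w) nq na =
      Matrix.diagonal fun x => (z : ℂ) ^ charge (flavorCharge i) x := by
  rw [constituentMat_quarkMat, h, diagonal_update_eq, pairMat_diagonal_zpow]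
  rfl

namespace Composite

variable {r : Multiplet n} (c : Composite Nc r)

/-- The tensors that form the multiplet. -/
def space : Submodule ℂ ((Fin c.nq → Fin n ⊕ Fin n) × (Fin c.na → Fin n ⊕ Fin n) → ℂ) :=
  LinearMap.range c.J

theorem mulVec_mem_space (gL gR : SU n) (w : Circle) {v} (hv : v ∈ c.space) :
    (constituentMat (quarkMat gL gR w) c.nq c.na).mulVec v ∈ c.space := by
  obtain ⟨v, rfl⟩ := hv
  exact ⟨_, c.map_act gL gR w v⟩

theorem pairMat_mulVec_mem_space (gL gR : SU n) {v} (hv : v ∈ c.space) :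
    (pairMat c.nq c.na (gL : Matrix (Fin n) (Fin n) ℂ) (gR : Matrix (Fin n) (Fin n) ℂ)).mulVec v ∈
      c.space := by
  have := c.mulVec_mem_space gL gR 1 hv
  rwa [constituentMat_quarkMat, Circle.coe_one, one_smul, one_smul] at this

theorem isGraded_flavorCharge (i : Fin n) : IsGraded c.space (charge (flavorCharge i)) := by
  refine isGraded_of_phase fun z v hv => ?_
  obtain ⟨g, w, hgw⟩ := exists_flavor_rotation i z
  have := c.mulVec_mem_space g g w hv
  rw [constituentMat_flavor_rotation hgw] at this
  convert this using 1
  ext x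
  rw [Matrix.mulVec_diagonal]

/-- The tensors of the multiplet on which the first `h` flavors have charges `H`. -/
def chargeSpace {h m : ℕ} (e : h + m = n) (H : Fin h → ℤ) :
    Submodule ℂ ((Fin c.nq → Fin n ⊕ Fin n) × (Fin c.na → Fin n ⊕ Fin n) → ℂ) :=
  c.space ⊓ suppOn {x | ∀ i, charge (flavorCharge (flavorSplit e (Sum.inl i))) x = H i}

end Composite

theorem mem_suppOn_forall {X ι : Type*} {P : ι → X → Prop} {v : X → ℂ} :
    v ∈ suppOn {x | ∀ i, P i x} ↔ ∀ i, v ∈ suppOn {x | P i x} := by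
  constructor
  · intro h i x hx
    exact h x fun h' => hx (h' i)
  · intro h x hx
    obtain ⟨i, hi⟩ := not_forall.1 hx
    exact h i x hi

theorem embedMat_commute_flavor {h m : ℕ} (e : h + m = n) (u : Matrix (Fin m) (Fin m) ℂ) (i : Fin h)
    (z : Circle) :
    Commute (embedMat e u) (Matrix.diagonal fun j =>
      (z : ℂ) ^ (Pi.single (flavorSplit e (Sum.inl i)) (1 : ℤ) : Fin n → ℤ) j) := by
  have h1 : (Matrix.diagonal fun j =>
      (z : ℂ) ^ (Pi.single (flavorSplit e (Sum.inl i)) (1 : ℤ) : Fin n → ℤ) j) =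
      Matrix.reindex (flavorSplit e) (flavorSplit e)
        (Matrix.fromBlocks (Matrix.diagonal fun j => (z : ℂ) ^ (Pi.single i (1 : ℤ) : Fin h → ℤ) j)
          0 0 (1 : Matrix (Fin m) (Fin m) ℂ)) := by
    rw [← Matrix.diagonal_one, Matrix.fromBlocks_diagonal, Matrix.reindex_apply,
      Matrix.submatrix_diagonal_equiv]
    congr 1
    ext j
    obtain ⟨j, rfl⟩ := (flavorSplit e).surjective j
    rcases j with j | j
    · simp only [Function.comp_apply, Equiv.symm_apply_apply, Sum.elim_inl]
      congr 1
      simp only [Pi.single_apply, (flavorSplit e).injective.eq_iff, Sum.inl.injEq]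
    · simp
  rw [h1, embedMat]
  simp only [Commute, SemiconjBy, Matrix.reindex_apply, Matrix.submatrix_mul_equiv,
    Matrix.fromBlocks_multiply]
  simp

/-- The tensors with `nq` quark and `na` antiquark indices, as a representation of
`SU(m) × SU(m)`. -/
def tensorRep {h m : ℕ} (e : h + m = n) (nq na : ℕ) : Representation ℂ (SU m × SU m)
    ((Fin nq → Fin n ⊕ Fin n) × (Fin na → Fin n ⊕ Fin n) → ℂ) where
  toFun g := Matrix.toLin' (pairMat nq na (embedMat e g.1) (embedMat e g.2))
  map_one' := by
    have hone : embedMat e ((1 : SU m) : Matrix (Fin m) (Fin m) ℂ) = 1 := embedMat_one e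
    rw [Prod.fst_one, Prod.snd_one, hone, pairMat_one, Matrix.toLin'_one]
    rfl
  map_mul' g g' := by
    have hmul : ∀ u v : SU m, embedMat e ((u * v : SU m) : Matrix (Fin m) (Fin m) ℂ) =
      embedMat e u * embedMat e v := fun u v => embedMat_mul e u v
    rw [Prod.fst_mul, Prod.snd_mul, hmul, hmul, ← pairMat_mul, Matrix.toLin'_mul]
    rfl

theorem tensorRep_apply {h m : ℕ} (e : h + m = n) (nq na : ℕ) (g : SU m × SU m)
    (v : (Fin nq → Fin n ⊕ Fin n) × (Fin na → Fin n ⊕ Fin n) → ℂ) :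
    tensorRep e nq na g v = (pairMat nq na (embedMat e g.1) (embedMat e g.2)).mulVec v := rfl

theorem isSemisimpleRepresentation_tensorRep {h m : ℕ} (e : h + m = n) (nq na : ℕ) :
    (tensorRep e nq na).IsSemisimpleRepresentation := by
  refine isSemisimpleRepresentation_of_unitary _
    (fun g => pairMat nq na (embedMat e g.1) (embedMat e g.2)) (fun g => rfl) fun g => ?_
  have h1 : ∀ u : SU m, (embedMat e (u : Matrix (Fin m) (Fin m) ℂ)).conjTranspose =
      embedMat e ((u⁻¹ : SU m) : Matrix (Fin m) (Fin m) ℂ) := by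
    intro u
    rw [embedMat, Matrix.conjTranspose_reindex, Matrix.fromBlocks_conjTranspose]
    simp only [Matrix.conjTranspose_zero, Matrix.conjTranspose_one]
    rfl
  rw [conjTranspose_pairMat, h1, h1]
  rfl

theorem continuous_pairMat_embedMat {h m : ℕ} (e : h + m = n) (nq na : ℕ) :
    Continuous fun g : SU m × SU m => pairMat nq na (embedMat e g.1) (embedMat e g.2) := by
  have h1 : Continuous fun g : SU m × SU m =>
      Matrix.fromBlocks (embedMat e (g.1 : Matrix (Fin m) (Fin m) ℂ)) 0 0
        (embedMat e (g.2 : Matrix (Fin m) (Fin m) ℂ)) :=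
    Continuous.matrix_fromBlocks
      ((continuous_embedMat e).comp (continuous_subtype_val.comp continuous_fst))
      continuous_const continuous_const
      ((continuous_embedMat e).comp (continuous_subtype_val.comp continuous_snd))
  refine continuous_matrix fun x y => ?_
  simp only [pairMat, constituentMat, Matrix.of_apply]
  refine Continuous.mul (continuous_finsetProd _ fun k _ => h1.matrix_elem _ _)
    (continuous_finsetProd _ fun k _ => continuous_star.comp (h1.matrix_elem _ _))

/-- With a linear retraction `P` onto `W`, the restricted operator is a linear function of the
ambient matrix, whose entries are polynomial in the entries of the group elements and their
conjugates. -/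
theorem continuous_subrepresentation_tensorRep {h m : ℕ} (e : h + m = n) (nq na : ℕ)
    (W : Submodule ℂ ((Fin nq → Fin n ⊕ Fin n) × (Fin na → Fin n ⊕ Fin n) → ℂ))
    (hW : IsInvariant (tensorRep e nq na) W) (ψ : Module.End ℂ W →ₗ[ℂ] ℂ) :
    Continuous fun g => ψ ((tensorRep e nq na).subrepresentation W hW g) := by
  obtain ⟨P, hP⟩ := W.subtype.exists_leftInverse_of_injective W.ker_subtype
  let T : Matrix _ _ ℂ →ₗ[ℂ] Module.End ℂ W :=
    (LinearMap.lcomp ℂ W W.subtype) ∘ₗ (LinearMap.compRight ℂ P) ∘ₗ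
      (Matrix.toLin' (R := ℂ) (m := (Fin nq → Fin n ⊕ Fin n) × (Fin na → Fin n ⊕ Fin n))
        (n := (Fin nq → Fin n ⊕ Fin n) × (Fin na → Fin n ⊕ Fin n))).toLinearMap
  have h1 : ∀ g, (tensorRep e nq na).subrepresentation W hW g =
      T (pairMat nq na (embedMat e g.1) (embedMat e g.2)) := by
    intro g
    refine LinearMap.ext fun w => ?_
    exact (LinearMap.congr_fun hP ((tensorRep e nq na).subrepresentation W hW g w)).symm
  simp_rw [h1]
  exact ((ψ ∘ₗ T).continuous_of_finiteDimensional).comp (continuous_pairMat_embedMat e nq na)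

theorem Composite.isInvariant_chargeSpace {r : Multiplet n} (c : Composite Nc r) {h m : ℕ}
    (e : h + m = n) (H : Fin h → ℤ) :
    IsInvariant (tensorRep e c.nq c.na) (c.chargeSpace e H) := by
  rintro g v ⟨hv, hv'⟩
  rw [tensorRep_apply]
  refine ⟨c.pairMat_mulVec_mem_space (embedSU e g.1) (embedSU e g.2) hv, ?_⟩
  rw [SetLike.mem_coe, mem_suppOn_forall] at hv' ⊢
  intro i
  have := hv' i
  rw [setOf_eq_setOf_zpow_circle] at this ⊢
  refine mulVec_mem_suppOn_of_commute ?_ this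
  rw [flavorCharge, ← pairMat_diagonal_zpow, Commute, SemiconjBy, pairMat_mul, pairMat_mul,
    (embedMat_commute_flavor e _ i _).eq, (embedMat_commute_flavor e _ i _).eq]

end Composites

/-! ### Branching multiplicities as multiplicities in tensor spaces. -/

section Branching

variable {n h m : ℕ} {Nc : ℕ} {r : Multiplet n}

/-- The equivariant map into the tensors that corresponds to an element of the branching space. -/
def Composite.branchingMap (c : Composite Nc r) (e : h + m = n) (sL sR : MatIrrep m) (H : Fin h → ℤ) :
    branchingHom Nc e r sL sR H →ₗ[ℂ]
      Representation.IntertwiningMap (sL.prodRep sR)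
        ((tensorRep e c.nq c.na).subrepresentation (c.chargeSpace e H)
          (c.isInvariant_chargeSpace e H)) where
  toFun F :=
    { toLinearMap := (c.J ∘ₗ Matrix.toLin' F.1).codRestrict (c.chargeSpace e H) fun v => by
        refine ⟨⟨_, rfl⟩, ?_⟩
        rw [SetLike.mem_coe, mem_suppOn_forall]
        intro i
        refine mem_suppOn_iff_phase.2 fun z x => ?_
        obtain ⟨g, w, hgw⟩ := exists_flavor_rotation (flavorSplit e (Sum.inl i)) z
        have h1 := c.map_act g g w (F.1.mulVec v)
        rw [Matrix.mulVec_mulVec, F.2.2 i g w z hgw, constituentMat_flavor_rotation hgw,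
          Matrix.smul_mulVec, map_smul] at h1
        have h2 := congrFun h1 x
        rw [Matrix.mulVec_diagonal] at h2
        exact h2.symm
      isIntertwining' := fun g => by
        refine LinearMap.ext fun v => Subtype.ext ?_
        change c.J (F.1.mulVec ((sL.mat g.1 ⊗ₖ sR.mat g.2).mulVec v)) =
          (pairMat c.nq c.na (embedMat e g.1) (embedMat e g.2)).mulVec (c.J (F.1.mulVec v))
        have h1 := c.map_act (embedSU e g.1) (embedSU e g.2) 1 (F.1.mulVec v)
        rw [Matrix.mulVec_mulVec, F.2.1, constituentMat_quarkMat, Circle.coe_one, one_smul,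
          one_smul] at h1
        rw [Matrix.mulVec_mulVec]
        exact h1 }
  map_add' F G := by
    refine Representation.IntertwiningMap.ext (LinearMap.ext fun v => Subtype.ext ?_)
    change c.J ((F.1 + G.1).mulVec v) = c.J (F.1.mulVec v) + c.J (G.1.mulVec v)
    rw [Matrix.add_mulVec, map_add]
  map_smul' a F := by
    refine Representation.IntertwiningMap.ext (LinearMap.ext fun v => Subtype.ext ?_)
    change c.J ((a • F.1).mulVec v) = a • c.J (F.1.mulVec v)
    rw [Matrix.smul_mulVec, map_smul]

theorem Composite.branchingMap_apply (c : Composite Nc r) (e : h + m = n) (sL sR : MatIrrep m)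
    (H : Fin h → ℤ) (F : branchingHom Nc e r sL sR H) (v : Fin sL.dim × Fin sR.dim → ℂ) :
    ((c.branchingMap e sL sR H F v : c.chargeSpace e H) :
      (Fin c.nq → Fin n ⊕ Fin n) × (Fin c.na → Fin n ⊕ Fin n) → ℂ) = c.J (F.1.mulVec v) := rfl

/-- Vectors of the charge sector lie in the image of `c.J`, so an intertwiner into it is pulled back
by a left inverse `K` of `c.J`; the equivariance conditions are checked after applying the injective
`c.J`. -/
theorem Composite.branchingMap_bijective (c : Composite Nc r) (e : h + m = n) (sL sR : MatIrrep m)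
    (H : Fin h → ℤ) : Function.Bijective (c.branchingMap e sL sR H) := by
  have hext : ∀ A B : Matrix (Fin r.L.dim × Fin r.R.dim) (Fin sL.dim × Fin sR.dim) ℂ,
      (∀ v, c.J (A.mulVec v) = c.J (B.mulVec v)) → A = B := fun A B hAB =>
    Matrix.toLin'.injective (LinearMap.ext fun v => c.inj (hAB v))
  constructor
  · intro F G hFG
    refine Subtype.ext (hext _ _ fun v => ?_)
    rw [← c.branchingMap_apply, ← c.branchingMap_apply, hFG]
  · intro Ψ
    obtain ⟨K, hK⟩ := c.J.exists_leftInverse_of_injective (LinearMap.ker_eq_bot.2 c.inj)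
    let F : Matrix (Fin r.L.dim × Fin r.R.dim) (Fin sL.dim × Fin sR.dim) ℂ :=
      LinearMap.toMatrix' (K ∘ₗ (c.chargeSpace e H).subtype ∘ₗ Ψ.toLinearMap)
    have hF : ∀ v, c.J (F.mulVec v) = Ψ v := by
      intro v
      obtain ⟨u, hu⟩ := (Ψ v).2.1
      have h1 : F.mulVec v = K (Ψ v : c.chargeSpace e H) := LinearMap.toMatrix'_mulVec _ v
      rw [h1, ← hu]
      exact congrArg c.J (LinearMap.congr_fun hK u)
    refine ⟨⟨F, fun u v => hext _ _ fun x => ?_, fun i g w z hgw => hext _ _ fun x => ?_⟩, ?_⟩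
    · rw [← Matrix.mulVec_mulVec, ← Matrix.mulVec_mulVec, c.map_act, hF, hF, constituentMat_quarkMat,
        Circle.coe_one, one_smul, one_smul]
      have := congrArg Subtype.val (LinearMap.congr_fun (Ψ.isIntertwining' (u, v)) x)
      exact this.symm
    · rw [← Matrix.mulVec_mulVec, c.map_act, hF, Matrix.smul_mulVec, map_smul, hF,
        constituentMat_flavor_rotation hgw]
      ext y
      rw [Matrix.mulVec_diagonal]
      exact mem_suppOn_iff_phase.1 (mem_suppOn_forall.1 (Ψ x).2.2 i) z y
    · refine Representation.IntertwiningMap.ext (LinearMap.ext fun v => Subtype.ext ?_)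
      exact hF v

theorem Composite.finrank_branchingHom (c : Composite Nc r) (e : h + m = n) (sL sR : MatIrrep m)
    (H : Fin h → ℤ) :
    Module.finrank ℂ (branchingHom Nc e r sL sR H) =
      Module.finrank ℂ (Representation.IntertwiningMap (sL.prodRep sR)
        ((tensorRep e c.nq c.na).subrepresentation (c.chargeSpace e H)
          (c.isInvariant_chargeSpace e H))) :=
  (LinearEquiv.ofBijective _ (c.branchingMap_bijective e sL sR H)).finrank_eq

/-- The diagonal elements of `SU(n)` with integer weights of sum zero. -/
def torus (f : Fin n → ℤ) (hf : ∑ i, f i = 0) (z : Circle) : SU n :=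
  ⟨Matrix.diagonal fun i => (z : ℂ) ^ f i, by
    refine Matrix.mem_specialUnitaryGroup_iff.2 ⟨diagonal_zpow_mem_unitaryGroup f z, ?_⟩
    rw [Matrix.det_diagonal]
    have : ∀ s : Finset (Fin n), ∏ i ∈ s, (z : ℂ) ^ f i = (z : ℂ) ^ ∑ i ∈ s, f i := by
      intro s
      induction s using Finset.induction_on with
      | empty => simp
      | insert a s ha ih => rw [Finset.prod_insert ha, Finset.sum_insert ha, ih,
          zpow_add₀ z.coe_ne_zero]
    rw [this, hf, zpow_zero]⟩

theorem coe_torus (f : Fin n → ℤ) (hf : ∑ i, f i = 0) (z : Circle) :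
    (torus f hf z : Matrix (Fin n) (Fin n) ℂ) = Matrix.diagonal fun i => (z : ℂ) ^ f i := rfl

theorem Composite.isGraded_charge_left (c : Composite Nc r) (f : Fin n → ℤ) (hf : ∑ i, f i = 0) :
    IsGraded c.space (charge (Sum.elim f 0)) := by
  refine isGraded_of_phase fun z v hv => ?_
  have := c.pairMat_mulVec_mem_space (torus f hf z) 1 hv
  rw [coe_torus, OneMemClass.coe_one, pairMat_diagonal_zpow_left] at this
  convert this using 1
  ext x
  rw [Matrix.mulVec_diagonal]

/-- If all multiplicities of a virtual multiplet in a sector of given flavor charges vanish, then so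
do the moments of the weights in this sector. -/
theorem sum_moment_chargeSpace_eq_zero {ι : Type*} [Fintype ι] (r : ι → Multiplet n)
    (c : ∀ i, Composite Nc (r i)) (a : ι → ℤ) (e : h + m = n) (H : Fin h → ℤ)
    (hmult : ∀ sL sR : MatIrrep m,
      ∑ i, a i * (Module.finrank ℂ (branchingHom Nc e (r i) sL sR H) : ℤ) = 0)
    (f : Fin n → ℤ) (hf : ∑ i, f i = 0) (hf0 : ∀ i : Fin h, f (flavorSplit e (Sum.inl i)) = 0)
    (C : Finset ℤ) (hC : ∀ i, ∀ x : (Fin (c i).nq → Fin n ⊕ Fin n) × (Fin (c i).na → Fin n ⊕ Fin n),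
      charge (Sum.elim f 0) x ∈ C) :
    ∑ i, a i * moment ((c i).chargeSpace e H) (charge (Sum.elim f 0)) C = 0 := by
  have hf' : ∑ j : Fin m, f (flavorSplit e (Sum.inr j)) = 0 := by
    have h1 := (flavorSplit e).sum_comp f
    rw [hf, Fintype.sum_sum_type] at h1
    simpa [hf0] using h1
  have htorus : ∀ z : Circle,
      embedMat e (torus (fun j : Fin m => f (flavorSplit e (Sum.inr j))) hf' z : Matrix _ _ ℂ) =
        Matrix.diagonal fun i => (z : ℂ) ^ f i := by
    intro z
    rw [coe_torus, embedMat_diagonal]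
    congr 1
    ext i
    obtain ⟨i, rfl⟩ := (flavorSplit e).surjective i
    rcases i with i | i
    · simp [hf0]
    · simp
  have htr := sum_trace_eq_zero_of_multiplicities (fun i => (c i).chargeSpace e H)
    (fun i => (tensorRep e (c i).nq (c i).na).subrepresentation ((c i).chargeSpace e H)
          ((c i).isInvariant_chargeSpace e H))
    (fun i => isSemisimpleRepresentation_subrepresentation _
      (isSemisimpleRepresentation_tensorRep e _ _) _ _)
    (fun i ψ => continuous_subrepresentation_tensorRep e _ _ _ _ ψ) a
    (fun sL sR => by
      rw [← hmult sL sR]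
      exact Finset.sum_congr rfl fun i _ => by rw [(c i).finrank_branchingHom])
  let N : ι → ℤ → ℕ := fun i d => Module.finrank ℂ ((c i).chargeSpace e H ⊓
    suppOn {x | charge (Sum.elim f 0) x = d} : Submodule ℂ _)
  -- The vanishing character, evaluated on the left torus. The weights `f` vanish on the first `h`
  -- flavors, so this torus lies in the embedded `SU(m)`. Its second derivative at `z = 1` is minus
  -- the moment.
  have hz : ∀ z : Circle, ∑ d ∈ C, (∑ i, (a i : ℂ) * N i d) * (z : ℂ) ^ d = 0 := by
    intro z
    rw [← htr (torus _ hf' z, 1)]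
    have h1 : ∀ i, LinearMap.trace ℂ _ ((tensorRep e (c i).nq (c i).na).subrepresentation
        ((c i).chargeSpace e H) ((c i).isInvariant_chargeSpace e H) (torus _ hf' z, 1)) =
        ∑ d ∈ C, (z : ℂ) ^ d * (N i d : ℂ) := by
      intro i
      refine trace_eq_sum_finrank (((c i).isGraded_charge_left f hf).inf_suppOn _) C (hC i)
        (fun d => (z : ℂ) ^ d) _ fun w x => ?_
      change (pairMat (c i).nq (c i).na (embedMat e (torus _ hf' z : Matrix _ _ ℂ))
        (embedMat e ((1 : SU m) : Matrix _ _ ℂ))).mulVec (w : _ → ℂ) x = _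
      rw [htorus, OneMemClass.coe_one, embedMat_one, pairMat_diagonal_zpow_left,
        Matrix.mulVec_diagonal]
    simp_rw [h1, Finset.mul_sum, Finset.sum_mul]
    rw [Finset.sum_comm]
    exact Finset.sum_congr rfl fun i _ => Finset.sum_congr rfl fun d _ => by ring
  have h2 := deriv_deriv_sum_zpow C fun d => ∑ i, (a i : ℂ) * N i d
  simp_rw [hz] at h2
  rw [deriv_const', deriv_const, eq_comm, neg_eq_zero] at h2
  have h3 : ((∑ i, a i * moment ((c i).chargeSpace e H) (charge (Sum.elim f 0)) C : ℤ) : ℂ) = 0 := by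
    rw [← h2]
    simp only [moment]
    push_cast
    simp_rw [Finset.mul_sum]
    rw [Finset.sum_comm]
    exact Finset.sum_congr rfl fun d _ => Finset.sum_congr rfl fun i _ => by simp only [N]; ring
  exact_mod_cast h3

end Branching

/-! ### The quadratic index of a multiplet as a moment of its weights. -/

section Anomalies

theorem deriv_deriv_trace_of_add {d : ℕ} (ρ : ℝ → Matrix (Fin d) (Fin d) ℂ) (h0 : ρ 0 = 1)
    (hadd : ∀ s t, ρ (s + t) = ρ s * ρ t) (hdiff : ∀ i j, DifferentiableAt ℝ (fun t => ρ t i j) 0) :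
    deriv (deriv fun t => (ρ t).trace) 0 =
      ((Matrix.of fun i j => deriv (fun t => ρ t i j) 0) ^ 2).trace := by
  set G : Matrix (Fin d) (Fin d) ℂ := Matrix.of fun i j => deriv (fun t => ρ t i j) 0 with hG
  -- The group law propagates differentiability from `0` to every `t` and gives `ρ' = G ρ`, so the
  -- second derivative of the trace at `0` is `tr G²`.
  have hρ : ∀ t i j, HasDerivAt (fun u => ρ u i j) ((G * ρ t) i j) t := by
    intro t i j
    have h1 : (fun u => ρ u i j) = fun u => ∑ k, ρ (u - t) i k * ρ t k j := by
      ext u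
      rw [← Matrix.mul_apply, ← hadd, sub_add_cancel]
    rw [h1, Matrix.mul_apply]
    refine HasDerivAt.fun_sum fun k _ => HasDerivAt.mul_const ?_ _
    have h2 : HasDerivAt (fun u => ρ u i k) (G i k) (t - t) := by
      rw [sub_self]
      exact (hdiff i k).hasDerivAt
    exact h2.comp_sub_const t t
  have h1 : (deriv fun t => (ρ t).trace) = fun t => ∑ i, ∑ k, G i k * ρ t k i := by
    ext t
    refine (HasDerivAt.fun_sum fun i _ => hρ t i i).deriv.trans ?_
    simp only [Matrix.mul_apply]
  rw [h1]
  refine (HasDerivAt.fun_sum fun i _ => HasDerivAt.fun_sum fun k _ =>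
    (hρ 0 k i).const_mul (G i k)).deriv.trans ?_
  simp only [h0, Matrix.mul_one]
  simp only [sq, Matrix.trace, Matrix.diag_apply, Matrix.mul_apply]

variable {n Nc : ℕ}

/-- A diagonal one-parameter subgroup of `SU(n)` with integer weights. -/
def torusPath (f : Fin n → ℤ) (hf : ∑ i, f i = 0) : OneParam n where
  path t := torus f hf (Circle.exp t)
  continuous_path := by
    refine Continuous.subtype_mk (Continuous.matrix_diagonal (continuous_pi fun i => ?_)) _
    simp only [coe_circle_exp_zpow]
    fun_prop
  map_add s t := by
    refine Subtype.ext ?_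
    change Matrix.diagonal _ = Matrix.diagonal _ * Matrix.diagonal _
    rw [Matrix.diagonal_mul_diagonal]
    congr 1
    ext i
    rw [Circle.exp_add, Circle.coe_mul, mul_zpow]

theorem trace_fundGen_torusPath_sq (f : Fin n → ℤ) (hf : ∑ i, f i = 0) :
    ((torusPath f hf).fundGen ^ 2).trace = -∑ i, (f i : ℂ) ^ 2 := by
  have h1 : (torusPath f hf).fundGen = Matrix.diagonal fun i => (f i : ℂ) * Complex.I := by
    ext i j
    change deriv (fun t : ℝ =>
      (Matrix.diagonal fun i => ((Circle.exp t : Circle) : ℂ) ^ f i) i j) 0 = _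
    rcases eq_or_ne i j with rfl | hij
    · simp only [Matrix.diagonal_apply_eq]
      rw [(hasDerivAt_circle_exp_zpow 0 (f i)).deriv]
      simp
    · simp only [Matrix.diagonal_apply_ne _ hij, deriv_const]
  rw [h1, Matrix.diagonal_pow, Matrix.trace_diagonal, ← Finset.sum_neg_distrib]
  refine Finset.sum_congr rfl fun i _ => ?_
  rw [Pi.pow_apply, mul_pow, Complex.I_sq, mul_neg_one]

theorem MatIrrep.dim_pos {m : ℕ} (s : MatIrrep m) : 0 < s.dim := by
  by_contra h
  have h0 : s.dim = 0 := by omega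
  refine ((isIrreducible_iff_isMinimalInvariant_top _).1 s.irreducible).ne_bot ?_
  rw [Submodule.eq_bot_iff]
  intro v _
  ext i
  exact absurd i.2 (by omega)

variable {r : Multiplet n}

theorem Composite.trace_act_torus (c : Composite Nc r) (f : Fin n → ℤ) (hf : ∑ i, f i = 0)
    (C : Finset ℤ) (hC : ∀ x : (Fin c.nq → Fin n ⊕ Fin n) × (Fin c.na → Fin n ⊕ Fin n),
      charge (Sum.elim f 0) x ∈ C) (z : Circle) :
    (r.L.mat (torus f hf z)).trace * (r.R.dim : ℂ) =
      ∑ d ∈ C, (Module.finrank ℂ (c.space ⊓ suppOn {x | charge (Sum.elim f 0) x = d} :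
        Submodule ℂ _) : ℂ) * (z : ℂ) ^ d := by
  have h1 : (r.L.mat (torus f hf z)).trace * (r.R.dim : ℂ) =
      LinearMap.trace ℂ _ (Matrix.toLin' (r.act Nc (torus f hf z) 1 1)) := by
    rw [Matrix.trace_toLin'_eq, Multiplet.act, Circle.coe_one, one_zpow, one_smul, map_one,
      Matrix.trace_kronecker, Matrix.trace_one, Fintype.card_fin]
  have h2 : ∀ v, c.J (Matrix.toLin' (r.act Nc (torus f hf z) 1 1) v) =
      fun x => (z : ℂ) ^ charge (Sum.elim f 0) x * c.J v x := by
    intro v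
    rw [Matrix.toLin'_apply, c.map_act, constituentMat_quarkMat, Circle.coe_one, one_smul, one_smul,
      coe_torus, OneMemClass.coe_one, pairMat_diagonal_zpow_left]
    ext x
    rw [Matrix.mulVec_diagonal]
  let E := LinearEquiv.ofInjective c.J c.inj
  rw [h1, ← LinearMap.trace_conj' _ E]
  refine (trace_eq_sum_finrank (c.isGraded_charge_left f hf) C hC (fun d => (z : ℂ) ^ d) _
    fun w x => ?_).trans (Finset.sum_congr rfl fun d _ => mul_comm _ _)
  obtain ⟨v, rfl⟩ := E.surjective w
  have h3 : E.conj (Matrix.toLin' (r.act Nc (torus f hf z) 1 1)) (E v) =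
      E (Matrix.toLin' (r.act Nc (torus f hf z) 1 1) v) := by
    rw [LinearEquiv.conj_apply_apply, E.symm_apply_apply]
  exact (congrFun (congrArg Subtype.val h3) x).trans (congrFun (h2 v) x)

/-- A `MatIrrep` is only assumed continuous, but inside the tensors the torus acts by diagonal
phases, so its matrix entries are finite combinations of integer powers of the phase. The fixed
index `a` of the right factor reads off an entry of the left matrix. -/
theorem Composite.differentiableAt_mat_torus (c : Composite Nc r) (f : Fin n → ℤ)
    (hf : ∑ i, f i = 0) (i j : Fin r.L.dim) (t : ℝ) :
    DifferentiableAt ℝ (fun t => r.L.mat (torus f hf (Circle.exp t)) i j) t := by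
  let a : Fin r.R.dim := ⟨0, r.R.dim_pos⟩
  obtain ⟨K, hK⟩ := c.J.exists_leftInverse_of_injective (LinearMap.ker_eq_bot.2 c.inj)
  let u := c.J (Pi.single (j, a) 1)
  have h1 : ∀ z : Circle, r.L.mat (torus f hf z) i j =
      ∑ x, ((z : ℂ) ^ charge (Sum.elim f 0) x * u x) * K (fun y => if x = y then 1 else 0) (i, a) := by
    intro z
    have h2 : r.L.mat (torus f hf z) i j =
        ((r.act Nc (torus f hf z) 1 1).mulVec (Pi.single (j, a) 1)) (i, a) := by
      rw [Matrix.mulVec_single_one, Multiplet.act, Circle.coe_one, one_zpow, one_smul, map_one,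
        Matrix.col_apply, Matrix.kroneckerMap_apply, Matrix.one_apply_eq, mul_one]
    have h3 : c.J ((r.act Nc (torus f hf z) 1 1).mulVec (Pi.single (j, a) 1)) =
        fun x => (z : ℂ) ^ charge (Sum.elim f 0) x * u x := by
      rw [c.map_act, constituentMat_quarkMat, Circle.coe_one, one_smul, one_smul,
        coe_torus, OneMemClass.coe_one, pairMat_diagonal_zpow_left]
      ext x
      rw [Matrix.mulVec_diagonal]
    have h4 := LinearMap.congr_fun hK ((r.act Nc (torus f hf z) 1 1).mulVec (Pi.single (j, a) 1))
    rw [LinearMap.comp_apply, h3, LinearMap.pi_apply_eq_sum_univ K] at h4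
    rw [h2]
    refine (congrFun h4.symm (i, a)).trans ?_
    rw [Finset.sum_apply]
    rfl
  simp_rw [h1]
  refine DifferentiableAt.fun_sum fun x _ => DifferentiableAt.mul_const
    (DifferentiableAt.mul_const ?_ _) _
  exact (hasDerivAt_circle_exp_zpow t _).differentiableAt

/-- The index of a multiplet is given by the weights of its tensors. -/
theorem Composite.trace_gen_sq (c : Composite Nc r) (f : Fin n → ℤ) (hf : ∑ i, f i = 0)
    (C : Finset ℤ) (hC : ∀ x : (Fin c.nq → Fin n ⊕ Fin n) × (Fin c.na → Fin n ⊕ Fin n),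
      charge (Sum.elim f 0) x ∈ C) :
    (r.L.gen (torusPath f hf) ^ 2).trace * (r.R.dim : ℂ) =
      -(moment c.space (charge (Sum.elim f 0)) C : ℂ) := by
  have h0 : torus f hf (Circle.exp 0) = 1 := by
    refine Subtype.ext ?_
    rw [coe_torus]
    simp
  have hpath := deriv_deriv_trace_of_add (fun t => r.L.mat (torus f hf (Circle.exp t)))
    (by rw [h0, map_one])
    (fun s t => by
      rw [← map_mul]
      exact congrArg _ ((torusPath f hf).map_add s t))
    (fun i j => c.differentiableAt_mat_torus f hf i j 0)
  have h1 : (r.L.gen (torusPath f hf) ^ 2).trace =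
    deriv (deriv fun t : ℝ => (r.L.mat (torus f hf (Circle.exp t))).trace) 0 := hpath.symm
  have h2 : ∀ t : ℝ, (r.L.mat (torus f hf (Circle.exp t))).trace * (r.R.dim : ℂ) = _ :=
    fun t => c.trace_act_torus f hf C hC (Circle.exp t)
  have h3 := deriv_deriv_sum_zpow C fun d => (Module.finrank ℂ
    (c.space ⊓ suppOn {x | charge (Sum.elim f 0) x = d} : Submodule ℂ _) : ℂ)
  simp_rw [← h2] at h3
  have h4 : (deriv fun t : ℝ => (r.L.mat (torus f hf (Circle.exp t))).trace * (r.R.dim : ℂ)) =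
      fun t => deriv (fun t : ℝ => (r.L.mat (torus f hf (Circle.exp t))).trace) t * (r.R.dim : ℂ) :=
    funext fun t => deriv_mul_const_field _
  rw [h4, deriv_mul_const_field, ← h1] at h3
  rw [h3, moment]
  push_cast
  rfl

end Anomalies

/-! ### Decoupling the first flavors, and divisibility of the neutral part. -/

section Descent

variable {n Nc : ℕ} {r : Multiplet n}

/-- The tensors of a multiplet that are neutral under the first `j` flavors. -/
def Composite.neutral (c : Composite Nc r) (j : ℕ) :
    Submodule ℂ ((Fin c.nq → Fin n ⊕ Fin n) × (Fin c.na → Fin n ⊕ Fin n) → ℂ) :=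
  c.space ⊓ suppOn {x | ∀ l : Fin n, (l : ℕ) < j → charge (flavorCharge l) x = 0}

theorem suppOn_inf_suppOn {X : Type*} (A B : Set X) : suppOn A ⊓ suppOn B = suppOn (A ∩ B) := by
  ext v
  constructor
  · rintro ⟨h1, h2⟩ x hx
    by_cases hA : x ∈ A
    · exact h2 x fun hB => hx ⟨hA, hB⟩
    · exact h1 x hA
  · exact fun h => ⟨fun x hx => h x fun h' => hx h'.1, fun x hx => h x fun h' => hx h'.2⟩

theorem Composite.neutral_zero (c : Composite Nc r) : c.neutral 0 = c.space := by
  rw [neutral, inf_eq_left]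
  intro v _ x hx
  exact absurd (fun l hl => absurd hl (Nat.not_lt_zero _)) hx

theorem Composite.neutral_succ (c : Composite Nc r) {j : ℕ} (hj : j < n) :
    c.neutral j ⊓ suppOn {x | charge (flavorCharge ⟨j, hj⟩) x = 0} = c.neutral (j + 1) := by
  rw [neutral, neutral, inf_assoc, suppOn_inf_suppOn]
  congr 2
  ext x
  constructor
  · rintro ⟨h1, h2⟩ l hl
    rcases Nat.lt_succ_iff_lt_or_eq.1 hl with h | h
    · exact h1 l h
    · rw [← show (⟨j, hj⟩ : Fin n) = l from Fin.ext h.symm]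
      exact h2
  · exact fun h => ⟨fun l hl => h l (hl.trans (Nat.lt_succ_self j)), h _ (Nat.lt_succ_self j)⟩

/-- The charges `(0, …, 0, q)` have exactly the shape to which the persistent mass conditions apply
when `q ≠ 0`. -/
theorem Composite.neutral_inf_suppOn (c : Composite Nc r) {j m : ℕ} (e : (j + 1) + m = n)
    (hj : j < n) (q : ℤ) :
    c.neutral j ⊓ suppOn {x | charge (flavorCharge ⟨j, hj⟩) x = q} =
      c.chargeSpace e (Fin.snoc (fun _ => 0) q) := by
  rw [neutral, chargeSpace, inf_assoc, suppOn_inf_suppOn]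
  congr 2
  ext x
  simp only [Set.mem_inter_iff, Set.mem_ofPred_eq]
  rw [Fin.forall_fin_succ']
  simp only [Fin.snoc_castSucc, Fin.snoc_last]
  refine and_congr ⟨fun h i => h _ ?_, fun h l hl => ?_⟩ ?_
  · rw [coe_flavorSplit_inl]
    exact i.2
  · rw [← h ⟨l, hl⟩]
    congr 2
  · rw [show flavorSplit e (Sum.inl (Fin.last j)) = ⟨j, hj⟩ from
      Fin.ext (by rw [coe_flavorSplit_inl]; rfl)]

theorem Composite.neutral_eq_chargeSpace (c : Composite Nc r) {h m : ℕ} (e : h + m = n) :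
    c.neutral h = c.chargeSpace e 0 := by
  rw [neutral, chargeSpace]
  congr 2
  ext x
  refine ⟨fun hx i => hx _ ?_, fun hx l hl => ?_⟩
  · rw [coe_flavorSplit_inl]
    exact i.2
  · have := hx ⟨l, hl⟩
    rwa [show flavorSplit e (Sum.inl ⟨l, hl⟩) = l from Fin.ext (coe_flavorSplit_inl _ _)] at this

/-- Every quark has exactly one flavor, so the last flavors carry whatever quark number the first
`h` do not. -/
theorem charge_lastFlavors {h m : ℕ} (e : h + m = n) {nq na : ℕ}
    (x : (Fin nq → Fin n ⊕ Fin n) × (Fin na → Fin n ⊕ Fin n)) :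
    charge (Sum.elim (lastFlavors e) (lastFlavors e)) x =
      (nq : ℤ) - na - ∑ i : Fin h, charge (flavorCharge (flavorSplit e (Sum.inl i))) x := by
  have h1 : ∀ q : Fin n ⊕ Fin n, (Sum.elim (lastFlavors e) (lastFlavors e) q : ℤ) =
      1 - ∑ i : Fin h, flavorCharge (flavorSplit e (Sum.inl i)) q := by
    have h2 : ∀ l : Fin n, lastFlavors e l =
        1 - ∑ i : Fin h, (Pi.single (flavorSplit e (Sum.inl i)) (1 : ℤ) : Fin n → ℤ) l := by
      intro l
      obtain ⟨l, rfl⟩ := (flavorSplit e).surjective l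
      simp only [Pi.single_apply, (flavorSplit e).injective.eq_iff]
      rcases l with l | l <;> simp [lastFlavors]
    rintro (l | l)
    · exact h2 l
    · exact h2 l
  simp only [charge, h1, Finset.sum_sub_distrib, Finset.sum_const, Finset.card_univ,
    Fintype.card_fin, nsmul_eq_mul, mul_one]
  rw [Finset.sum_comm, Finset.sum_comm (s := (Finset.univ : Finset (Fin na)))]
  ring

theorem Composite.sq_dvd_moment_neutral (c : Composite Nc r) {h p : ℕ} [hp : Fact p.Prime]
    (hpN : p ∣ Nc) (e : h + p = n) (f : Fin n → ℤ) (hf : ∑ i, f i = 0)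
    (hfp : ∀ i, (f i : ZMod p) = lastFlavors e i) (C : Finset ℤ)
    (hC : ∀ x : (Fin c.nq → Fin n ⊕ Fin n) × (Fin c.na → Fin n ⊕ Fin n),
      charge (Sum.elim f 0) x ∈ C) :
    (p : ℤ) ^ 2 ∣ moment (c.neutral h) (charge (Sum.elim f 0)) C := by
  rw [c.neutral_eq_chargeSpace e]
  refine sq_dvd_moment_of_invariant e (fun u v w hw => c.isInvariant_chargeSpace e 0 (u, v) w hw) f
    hfp (fun v hv x hx => hv.2 x fun hx' => hx ?_)
    ((c.isGraded_charge_left f hf).inf_suppOn _) C hC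
  change ((charge _ x : ℤ) : ZMod p) = 0
  rw [charge_lastFlavors e, Finset.sum_eq_zero fun i _ => hx' i, c.count, sub_zero,
    ZMod.intCast_zmod_eq_zero_iff_dvd]
  exact Dvd.dvd.mul_left (Int.natCast_dvd_natCast.2 hpN) _

/-- The persistent mass conditions hold at each baryon number separately; multiplying by `b` and
summing over the values that occur produces the weights of the mixed anomaly. -/
theorem PersistentMass.sum_baryon_mul_finrank {ℓ : Multiplet n →₀ ℤ} (hℓ : PersistentMass Nc ℓ)
    {k m : ℕ} (e : (k + 1) + m = n) (hm : 2 ≤ m) (sL sR : MatIrrep m) (H : Fin (k + 1) → ℤ)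
    (hH : ∀ i : Fin k, H i.castSucc = 0) (hH' : H (Fin.last k) ≠ 0) :
    ∑ r : ℓ.support, ℓ r * r.1.baryon *
      (Module.finrank ℂ (branchingHom Nc e r.1 sL sR H) : ℤ) = 0 := by
  classical
  have h1 := fun b => hℓ k m e hm sL sR b H hH hH'
  let B : Finset ℤ := ℓ.support.image fun r => r.baryon
  have h2 : ∑ b ∈ B, b * ∑ r ∈ ℓ.support, ℓ r * (branching Nc e r sL sR b H : ℤ) = 0 :=
    Finset.sum_eq_zero fun b _ => by
      have := h1 b
      rw [Finsupp.sum] at this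
      rw [this, mul_zero]
  rw [← h2]
  simp_rw [Finset.mul_sum]
  rw [Finset.sum_comm, Finset.sum_coe_sort ℓ.support fun r => ℓ r * r.baryon *
      (Module.finrank ℂ (branchingHom Nc e r sL sR H) : ℤ)]
  refine Finset.sum_congr rfl fun r hr => ?_
  rw [Finset.sum_eq_single r.baryon]
  · rw [branching, if_pos rfl]
    ring
  · intro b _ hb
    rw [branching, if_neg hb.symm]
    simp
  · exact fun h => absurd (Finset.mem_image_of_mem _ hr) h

/-- The persistent mass conditions allow one to decouple the first flavors one by one. -/
theorem PersistentMass.sum_moment_neutral {ℓ : Multiplet n →₀ ℤ} (hℓ : PersistentMass Nc ℓ)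
    (c : ∀ r : ℓ.support, Composite Nc r.1) {h p : ℕ} (hp : 2 ≤ p) (e : h + p = n)
    (f : Fin n → ℤ) (hf : ∑ i, f i = 0) (hf0 : ∀ i : Fin n, (i : ℕ) < h → f i = 0) (C : Finset ℤ)
    (hC : ∀ r, ∀ x : (Fin (c r).nq → Fin n ⊕ Fin n) × (Fin (c r).na → Fin n ⊕ Fin n),
      charge (Sum.elim f 0) x ∈ C) (j : ℕ) (hj : j ≤ h) :
    ∑ r : ℓ.support, ℓ r * r.1.baryon * moment ((c r).neutral j) (charge (Sum.elim f 0)) C =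
      ∑ r : ℓ.support, ℓ r * r.1.baryon * moment (c r).space (charge (Sum.elim f 0)) C := by
  induction j with
  | zero => simp_rw [Composite.neutral_zero]
  | succ j ih =>
    rw [← ih (Nat.le_of_succ_le hj), eq_comm]
    have hjn : j < n := by omega
    obtain ⟨m, hm⟩ : ∃ m, (j + 1) + m = n := ⟨n - (j + 1), by omega⟩
    -- All charges of flavor `j` that occur; `0` is inserted so that the neutral term is present
    -- even if no tensor has it.
    let C' : Finset ℤ := insert 0 (Finset.univ.biUnion fun r =>
      Finset.univ.image fun x => charge (na := (c r).na) (nq := (c r).nq) (flavorCharge ⟨j, hjn⟩) x)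
    have h1 : ∀ r, moment ((c r).neutral j) (charge (Sum.elim f 0)) C =
        ∑ q ∈ C', moment ((c r).neutral j ⊓ suppOn {x | charge (flavorCharge ⟨j, hjn⟩) x = q})
          (charge (Sum.elim f 0)) C := fun r =>
      moment_eq_sum_moment (((c r).isGraded_flavorCharge ⟨j, hjn⟩).inf_suppOn _) C C' fun x =>
        Finset.mem_insert_of_mem (Finset.mem_biUnion.2
          ⟨r, Finset.mem_univ r, Finset.mem_image_of_mem _ (Finset.mem_univ x)⟩)
    simp_rw [h1, Finset.mul_sum]
    rw [Finset.sum_comm, Finset.sum_eq_single 0]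
    · simp_rw [Composite.neutral_succ]
    · intro q _ hq
      simp_rw [fun r => (c r).neutral_inf_suppOn hm hjn q]
      -- A sector with `q ≠ 0` drops out. Since `j + 1 ≤ h`, at least `p ≥ 2` flavors remain
      -- massless and `f` vanishes on all the massive ones.
      refine sum_moment_chargeSpace_eq_zero (fun r : ℓ.support => r.1) c
        (fun r => ℓ r * r.1.baryon) hm _ (fun sL sR =>
          hℓ.sum_baryon_mul_finrank hm (by omega) sL sR _ (fun i => Fin.snoc_castSucc _ _ _)
            (by rw [Fin.snoc_last]; exact hq)) f hf (fun i => hf0 _ ?_) C hC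
      rw [coe_flavorSplit_inl]
      omega
    · exact fun h0 => absurd (Finset.mem_insert_self _ _) h0

end Descent

/-! ### The contradiction `p² ∣ p(p - 1)`. -/

section Main

/-- No spectrum of color-screened multiplets satisfies anomaly matching and the persistent mass
conditions. -/
theorem not_exists_massless_spectrum (Nc Nf : ℕ) (hNc : 3 ≤ Nc) (hNf : Nc.minFac ≤ Nf) :
    ¬ ∃ ℓ : Multiplet Nf →₀ ℤ, (∀ r : Multiplet Nf, ℓ r ≠ 0 → r.IsColorScreened Nc) ∧
      AnomalyMatching Nc ℓ ∧ PersistentMass Nc ℓ := by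
  rintro ⟨ℓ, hscreen, hamc, hpmc⟩
  obtain ⟨p, hpdef⟩ : ∃ p, p = Nc.minFac := ⟨_, rfl⟩
  have hp : p.Prime := hpdef ▸ Nat.minFac_prime (by omega)
  have hpN : p ∣ Nc := hpdef ▸ Nat.minFac_dvd Nc
  rw [← hpdef] at hNf
  have : Fact p.Prime := ⟨hp⟩
  obtain ⟨h, e⟩ : ∃ h, h + p = Nf := ⟨Nf - p, by omega⟩
  let c : ∀ r : ℓ.support, Composite Nc r.1 := fun r =>
    (hscreen r.1 (Finsupp.mem_support_iff.1 r.2)).nonempty_composite.some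
  let j₀ : Fin p := ⟨0, hp.pos⟩
  -- Congruent to `(1, …, 1)` mod `p` on the last `p` flavors, so that weights mod `p` read off the
  -- central charge of `SU(p)_L`; the entry `1 - p` makes the sum zero. The sum of squares `(p - 1)²
  -- + (p - 1) = p(p - 1)` has only one factor `p`.
  let f : Fin Nf → ℤ := Sum.elim 0 (fun j => 1 - if j = j₀ then (p : ℤ) else 0) ∘ (flavorSplit e).symm
  have hf : ∑ i, f i = 0 := by
    rw [← (flavorSplit e).sum_comp]
    simp [f, Fintype.sum_sum_type, Finset.sum_sub_distrib]
  have hf2 : ∑ i, f i ^ 2 = p * (p - 1) := by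
    have h1 : ∀ j : Fin p, (1 - if j = j₀ then (p : ℤ) else 0) ^ 2 =
        1 + if j = j₀ then ((p : ℤ) ^ 2 - 2 * p) else 0 := by
      intro j
      split_ifs <;> ring
    rw [← (flavorSplit e).sum_comp, Fintype.sum_sum_type]
    simp only [f, Function.comp_apply, Equiv.symm_apply_apply, Sum.elim_inl, Sum.elim_inr, h1,
      Finset.sum_add_distrib, Finset.sum_ite_eq', Finset.mem_univ, if_true]
    simp
    ring
  have hf0 : ∀ i : Fin Nf, (i : ℕ) < h → f i = 0 := by
    intro i hi
    rw [show i = flavorSplit e (Sum.inl ⟨i, hi⟩) from Fin.ext (coe_flavorSplit_inl e ⟨i, hi⟩).symm]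
    simp [f]
  have hfp : ∀ i, (f i : ZMod p) = lastFlavors e i := by
    intro i
    simp only [f, lastFlavors, Function.comp_apply]
    rcases (flavorSplit e).symm i with j | j
    · simp
    · simp only [Sum.elim_inr]
      split_ifs <;> simp
  let C : Finset ℤ := Finset.univ.biUnion fun r : ℓ.support => Finset.univ.image
    fun x : (Fin (c r).nq → Fin Nf ⊕ Fin Nf) × (Fin (c r).na → Fin Nf ⊕ Fin Nf) =>
      charge (Sum.elim f 0) x
  have hC : ∀ r, ∀ x : (Fin (c r).nq → Fin Nf ⊕ Fin Nf) × (Fin (c r).na → Fin Nf ⊕ Fin Nf),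
      charge (Sum.elim f 0) x ∈ C := fun r x => Finset.mem_biUnion.2
    ⟨r, Finset.mem_univ r, Finset.mem_image_of_mem _ (Finset.mem_univ x)⟩
  have hanomaly : ∑ r : ℓ.support, ℓ r * r.1.baryon *
      moment (c r).space (charge (Sum.elim f 0)) C = p * (p - 1) := by
    have h1 := hamc.mixedL (torusPath f hf)
    have hNc0 : (Nc : ℂ) ≠ 0 := Nat.cast_ne_zero.2 (by omega)
    rw [trace_fundGen_torusPath_sq, Finsupp.sum, ← Finset.sum_coe_sort] at h1
    have h2 : ∀ r : ℓ.support, (ℓ r : ℂ) * ((r.1.L.gen (torusPath f hf) ^ 2).trace *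
        (r.1.R.dim : ℂ) * (r.1.baryon : ℂ)) =
        -(ℓ r * r.1.baryon * (moment (c r).space (charge (Sum.elim f 0)) C : ℂ)) := by
      intro r
      rw [(c r).trace_gen_sq f hf C (hC r)]
      ring
    simp_rw [h2] at h1
    rw [Finset.sum_neg_distrib] at h1
    rw [← hf2]
    have h3 : ((∑ r : ℓ.support, ℓ r * r.1.baryon *
        moment (c r).space (charge (Sum.elim f 0)) C : ℤ) : ℂ) = ((∑ i, f i ^ 2 : ℤ) : ℂ) := by
      push_cast
      have h4 : (Nc : ℂ) * (-∑ i, (f i : ℂ) ^ 2) * (1 / (Nc : ℂ)) = -∑ i, (f i : ℂ) ^ 2 := by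
        field_simp
      rw [← mul_assoc, h4] at h1
      exact neg_injective h1
    exact_mod_cast h3
  -- The anomaly is carried entirely by tensors neutral under the first `h` flavors, and each of
  -- their moments is divisible by `p²`.
  have hdvd : (p : ℤ) ^ 2 ∣ p * (p - 1) := by
    rw [← hanomaly, ← hpmc.sum_moment_neutral c hp.two_le e f hf hf0 C hC h le_rfl]
    exact Finset.dvd_sum fun r _ =>
      ((c r).sq_dvd_moment_neutral hpN e f hf hfp C (hC r)).mul_left _
  have hp0 : (p : ℤ) ≠ 0 := by exact_mod_cast hp.ne_zero
  rw [sq] at hdvd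
  have h1 : (p : ℤ) ∣ p - 1 := (mul_dvd_mul_iff_left hp0).1 hdvd
  have h2 : (p : ℤ) ∣ 1 := by
    have := dvd_sub (dvd_refl (p : ℤ)) h1
    rwa [sub_sub_cancel] at this
  have h3 := Int.le_of_dvd one_pos h2
  have h4 := hp.two_le
  omega

end Main

end ChiralQCD

end

theorem theorem1 (Nc Nf : ℕ) (hNc : 3 ≤ Nc) (hNf : Nc.minFac ≤ Nf) :
    ¬ ∃ ℓ : ChiralQCD.Multiplet Nf →₀ ℤ,
      (∀ r : ChiralQCD.Multiplet Nf, ℓ r ≠ 0 → r.IsColorScreened Nc) ∧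
      ChiralQCD.AnomalyMatching Nc ℓ ∧
      ChiralQCD.PersistentMass Nc ℓ :=
  ChiralQCD.not_exists_massless_spectrum Nc Nf hNc hNf
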